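/- Let $[4]=\{1,2,3,4\}$. A CI couple $ij|C$ consists of a two-element set $ij=\{i,j\}\subseteq[4]$ and a set $C\subseteq[4]\setminus\{i,j\}$ (written $ij$ if $C=\emptyset$, and with $C$ written as a string of its elements). A relation on $[4]$ is a set $\mathcal L$ of CI couples. For a $4\times4$ matrix $M$, let $M_{iC,jC}$ be the submatrix with rows $\{i\}\cup C$ and columns $\{j\}\cup C$. The relation $\mathcal L$ is *representable* if there is a real symmetric positive definite $4\times 4$ matrix $\Sigma$ such that, for every CI couple $ij|C$, $\det(\Sigma_{iC,jC})=0$ if and only if $ij|C\in\mathcal L$. It is *complete* if for every couple $ij|C\notin\mathcal L$ there is a real symmetric positive definite $4\times 4$ matrix $\Sigma$ with $\det(\Sigma_{kD,lD})=0$ for all $kl|D\in\mathcal L$ and $\det(\Sigma_{iC,jC})\neq0$. Let $R=(r_{ij})$ be the generic symmetric $4\times4$ matrix with ones on the diagonal and variables $r_{ij}$, $1\le i<j\le4$, off the diagonal. The conditional independence ideal of $\mathcal L$ is $$I_{\mathcal L}=\langle \det(R_{iC,jC}) : ij|C\in\mathcal L\rangle\subseteq\mathbb R[r_{ij}:1\le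 i<j\le 4].$$ (i) If $\mathcal L$ is a representable relation on $[4]$, then $I_{\mathcal L}$ is a radical ideal. (ii) Completeness of $\mathcal L$ does not suffice: the relation $\{12,\ 12|4,\ 14|3,\ 14|23,\ 24,\ 24|1\}$ is complete, but its ideal is not radical. (iii) The ideal of the relation $\{12,\ 14|3,\ 14|23,\ 23|14\}$ is not radical either. -/

import Mathlib

/-- A conditional independence couple `ij|C` over `[m]`: a two-element set `{i, j}`, stored as
`i < j`, together with a conditioning set `C ⊆ [m] \ {i, j}`.  The index set `[m] = {1, …, m}` is
`Fin m`, so that `k ∈ [m]` is the element `k - 1` of `Fin m`. -/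
@[ext]
structure CICouple (m : ℕ) where
  i : Fin m
  j : Fin m
  C : Finset (Fin m)
  lt : i < j := by decide
  i_notMem : i ∉ C := by decide
  j_notMem : j ∉ C := by decide

/-- A conditional independence relation on `[m]` is a set of couples. -/
abbrev CIRelation (m : ℕ) := Set (CICouple m)

/-- The minor `det (M_{iC,jC})`: the index `i` labels the first row, `j` labels the first column,
and the remaining rows and columns are both labelled by the elements of `C`.  (Another ordering of
rows and columns changes it at most by a sign.) -/
def CICouple.minor {m : ℕ} {R : Type*} [CommRing R] (c : CICouple m)
    (M : Matrix (Fin m) (Fin m) R) : R :=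
  (M.submatrix
    (Sum.elim (fun _ : Unit => c.i) (fun k : {k : Fin m // k ∈ c.C} => (k : Fin m)))
    (Sum.elim (fun _ : Unit => c.j) (fun k : {k : Fin m // k ∈ c.C} => (k : Fin m)))).det

namespace CIRelation

/-- `V_pd(L)`: the positive definite matrices that satisfy all couples of `L`. -/
def Vpd {m : ℕ} (L : CIRelation m) : Set (Matrix (Fin m) (Fin m) ℝ) :=
  {S | S.PosDef ∧ ∀ c ∈ L, c.minor S = 0}

/-- `L(W)`: the couples that are satisfied by all the matrices in `W`. -/
def ofMatrices {m : ℕ} (W : Set (Matrix (Fin m) (Fin m) ℝ)) : CIRelation m :=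
  {c | ∀ S ∈ W, c.minor S = 0}

/-- `L` is representable: some covariance matrix satisfies exactly the couples of `L`. -/
def Representable {m : ℕ} (L : CIRelation m) : Prop :=
  ∃ S : Matrix (Fin m) (Fin m) ℝ, S.PosDef ∧ ∀ c : CICouple m, c.minor S = 0 ↔ c ∈ L

/-- `L` is complete: `L = L(V_pd(L))`. -/
def Complete {m : ℕ} (L : CIRelation m) : Prop :=
  L = ofMatrices L.Vpd

end CIRelation

/-- The index set `{(i, j) : 1 ≤ i < j ≤ m}` of the variables `r_ij`. -/
abbrev CorVar (m : ℕ) := {p : Fin m × Fin m // p.1 < p.2}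

/-- The generic correlation matrix over `ℝ[r_ij : i < j]`: symmetric, with ones on the diagonal and
the variable `r_ij` in the positions `(i, j)` and `(j, i)`. -/
noncomputable def genericCor (m : ℕ) : Matrix (Fin m) (Fin m) (MvPolynomial (CorVar m) ℝ) :=
  Matrix.of fun i j =>
    if h : i < j then MvPolynomial.X ⟨(i, j), h⟩
    else if h : j < i then MvPolynomial.X ⟨(j, i), h⟩
    else 1

/-- The conditional independence ideal `I_L = ⟨det (R_{iC,jC}) : ij|C ∈ L⟩ ⊆ ℝ[r_ij : i < j]`. -/
noncomputable def CIRelation.ciIdeal {m : ℕ} (L : CIRelation m) :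
    Ideal (MvPolynomial (CorVar m) ℝ) :=
  Ideal.span {f | ∃ c ∈ L, f = c.minor (genericCor m)}

/-! Rescaling a positive definite matrix to unit diagonal does not change which of the 24 minors
vanish. A relation is therefore encoded by a 24-digit binary number `v`, and its ideal by `maskIdeal
v` in six variables. The relation of a positive definite matrix satisfies the gaussoid axioms
(`gaussoidAxioms_of_posDef`), and a search evaluated by the kernel shows that every number
satisfying them is equivalent under S₄ to one of 58 representatives (`search_gaussoids`). As S₄ acts
by permuting variables, only the representatives matter (`gaussoid_induction`). Two of them are not
representable, by explicit inequalities; the other 56 have radical ideals.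

Radicality comes from elimination (`maskIdeal_isRadical_of_elimination`): minors that are linear in
a variable with constant coefficient remove that variable. If nothing remains, the ideal is prime.
If one polynomial remains, it is squarefree: on a suitable line it keeps its degree and is
separable, which an integral Bézout identity certifies (`squarefree_of_lineCheck`). If two remain,
either both are linear in a common variable and their resultant is squarefree
(`span_linear_pair_isRadical`), or they combine into products of linear forms and the ideal is an
intersection (`span_mul_isRadical`).

For the two counterexamples, a polynomial whose square lies in the ideal is nonzero at a dual-number
point of the ideal's scheme (`not_maskIdeal_isRadical`). Completeness is shown by positive definite
points near the identity, on the components of the variety. -/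

/-! ### Numbering of the couples and their expanded minors -/

/-- The symmetric matrix with unit diagonal and off-diagonal entries
`x 0, …, x 5 = r₁₂, r₁₃, r₁₄, r₂₃, r₂₄, r₃₄`. -/
def corMatrix {B : Type*} [CommRing B] (x : Fin 6 → B) : Matrix (Fin 4) (Fin 4) B :=
  !![1, x 0, x 1, x 2; x 0, 1, x 3, x 4; x 1, x 3, 1, x 5; x 2, x 4, x 5, 1]

/-- The 24 couples over `[4]`. -/
def couple : Fin 24 → CICouple 4 :=
  ![CICouple.mk 0 1 ∅, CICouple.mk 0 1 {2}, CICouple.mk 0 1 {3}, CICouple.mk 0 1 {2, 3},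
    CICouple.mk 0 2 ∅, CICouple.mk 0 2 {1}, CICouple.mk 0 2 {3}, CICouple.mk 0 2 {1, 3},
    CICouple.mk 0 3 ∅, CICouple.mk 0 3 {1}, CICouple.mk 0 3 {2}, CICouple.mk 0 3 {1, 2},
    CICouple.mk 1 2 ∅, CICouple.mk 1 2 {0}, CICouple.mk 1 2 {3}, CICouple.mk 1 2 {0, 3},
    CICouple.mk 1 3 ∅, CICouple.mk 1 3 {0}, CICouple.mk 1 3 {2}, CICouple.mk 1 3 {0, 2},
    CICouple.mk 2 3 ∅, CICouple.mk 2 3 {0}, CICouple.mk 2 3 {1}, CICouple.mk 2 3 {0, 1}]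

/-- The minors of `corMatrix x` that belong to the 24 couples, expanded. -/
def coupleMinor {B : Type*} [CommRing B] (n : ℕ) (x : Fin 6 → B) : B :=
  match n with
  | 0 => x 0
  | 1 => x 0 - x 1 * x 3
  | 2 => x 0 - x 2 * x 4
  | 3 => x 0 - x 1 * x 3 - x 2 * x 4 - x 0 * x 5 ^ 2 + x 1 * x 4 * x 5 + x 2 * x 3 * x 5
  | 4 => x 1
  | 5 => x 1 - x 0 * x 3
  | 6 => x 1 - x 2 * x 5
  | 7 => x 1 - x 0 * x 3 - x 2 * x 5 + x 0 * x 4 * x 5 - x 1 * x 4 ^ 2 + x 2 * x 3 * x 4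
  | 8 => x 2
  | 9 => x 2 - x 0 * x 4
  | 10 => x 2 - x 1 * x 5
  | 11 => x 2 - x 0 * x 4 - x 1 * x 5 + x 0 * x 3 * x 5 + x 1 * x 3 * x 4 - x 2 * x 3 ^ 2
  | 12 => x 3
  | 13 => x 3 - x 0 * x 1
  | 14 => x 3 - x 4 * x 5
  | 15 => x 3 - x 0 * x 1 - x 4 * x 5 + x 0 * x 2 * x 5 + x 1 * x 2 * x 4 - x 2 ^ 2 * x 3
  | 16 => x 4
  | 17 => x 4 - x 0 * x 2
  | 18 => x 4 - x 3 * x 5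
  | 19 => x 4 - x 0 * x 2 - x 3 * x 5 + x 0 * x 1 * x 5 - x 1 ^ 2 * x 4 + x 1 * x 2 * x 3
  | 20 => x 5
  | 21 => x 5 - x 1 * x 2
  | 22 => x 5 - x 3 * x 4
  | 23 => x 5 - x 1 * x 2 - x 3 * x 4 - x 0 ^ 2 * x 5 + x 0 * x 1 * x 4 + x 0 * x 2 * x 3
  | _ => 0

theorem exists_couple_eq (c : CICouple 4) : ∃ n, couple n = c := by
  obtain ⟨i, j, C, h, hi, hj⟩ := c
  simp only [CICouple.ext_iff]
  revert i j C
  decide +kernel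

/-- An enumeration `t` of the conditioning set reindexes rows and columns simultaneously, so no sign
appears, and the explicit formulas for small determinants become applicable. -/
theorem CICouple.minor_eq_det {R : Type*} [CommRing R] {m n : ℕ} (c : CICouple m)
    (M : Matrix (Fin m) (Fin m) R) (t : Fin n → Fin m) (ht : Function.Injective t)
    (hC : ∀ k, k ∈ c.C ↔ ∃ a, t a = k) :
    c.minor M = (M.submatrix (Fin.cons c.i t : Fin (n + 1) → Fin m) (Fin.cons c.j t)).det := by
  let e : Fin (n + 1) → Unit ⊕ {k : Fin m // k ∈ c.C} :=
    Fin.cons (Sum.inl ()) fun a => Sum.inr ⟨t a, (hC _).2 ⟨a, rfl⟩⟩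
  have he : Function.Bijective e := by
    constructor
    · intro a b
      refine Fin.cases ?_ (fun a => ?_) a <;> refine Fin.cases ?_ (fun b => ?_) b <;>
        simp [e, ht.eq_iff]
    · rintro (u | ⟨k, hk⟩)
      · exact ⟨0, rfl⟩
      · obtain ⟨a, rfl⟩ := (hC k).1 hk
        exact ⟨a.succ, by simp [e]⟩
  rw [CICouple.minor, ← Matrix.det_submatrix_equiv_self (Equiv.ofBijective e he),
    Matrix.submatrix_submatrix]
  congr 2 <;> funext a <;> refine Fin.cases ?_ (fun a => ?_) a <;> simp [e]

theorem minor_couple {B : Type*} [CommRing B] (n : Fin 24) (x : Fin 6 → B) :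
    (couple n).minor (corMatrix x) = coupleMinor n x := by
  have h0 : ∀ (i j : Fin 4) (h h1 h2) (M : Matrix (Fin 4) (Fin 4) B),
      (CICouple.mk i j ∅ h h1 h2).minor M = M i j := fun i j h h1 h2 M => by
    rw [CICouple.minor_eq_det _ _ ![] (fun a => a.elim0) (by simp)]
    exact Matrix.det_fin_one _
  have h1 : ∀ (i j k : Fin 4) (h h1 h2) (M : Matrix (Fin 4) (Fin 4) B),
      (CICouple.mk i j {k} h h1 h2).minor M = M i j * M k k - M i k * M k j :=
    fun i j k h h1 h2 M => by
    rw [CICouple.minor_eq_det _ _ ![k] (Function.injective_of_subsingleton _)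
      (by simp [eq_comm])]
    exact Matrix.det_fin_two _
  have h2 : ∀ (i j k l : Fin 4) (_ : k ≠ l) (h h1 h2) (M : Matrix (Fin 4) (Fin 4) B),
      (CICouple.mk i j {k, l} h h1 h2).minor M =
        M i j * M k k * M l l - M i j * M k l * M l k - M i k * M k j * M l l
        + M i k * M k l * M l j + M i l * M k j * M l k - M i l * M k k * M l j :=
    fun i j k l hkl h h1 h2 M => by
    rw [CICouple.minor_eq_det _ _ ![k, l] (by
      intro a b; fin_cases a <;> fin_cases b <;> simp [hkl, hkl.symm])
      (by simp [eq_comm])]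
    exact Matrix.det_fin_three _
  fin_cases n <;>
    simp [couple, h0, h1, h2, corMatrix, coupleMinor] <;> ring

/-! ### Ideals of relations in six numbered variables -/

section

open MvPolynomial

theorem map_coupleMinor {B D F : Type*} [CommRing B] [CommRing D] [FunLike F B D]
    [RingHomClass F B D] (f : F) (n : ℕ) (x : Fin 6 → B) :
    f (coupleMinor n x) = coupleMinor n fun i => f (x i) := by
  unfold coupleMinor
  split <;> simp

/-- The ideal generated by the minors of the generic correlation matrix whose numbers are the
binary digits of `v`. -/
noncomputable def maskIdeal (v : ℕ) : Ideal (MvPolynomial (Fin 6) ℝ) :=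
  Ideal.span {g | ∃ n : Fin 24, v.testBit n = true ∧ g = coupleMinor n X}

/-- The numbering of the variables. -/
noncomputable def varEquiv : Fin 6 ≃ CorVar 4 :=
  Equiv.ofBijective
    ![⟨(0, 1), by decide⟩, ⟨(0, 2), by decide⟩, ⟨(0, 3), by decide⟩, ⟨(1, 2), by decide⟩,
      ⟨(1, 3), by decide⟩, ⟨(2, 3), by decide⟩] (by decide)

theorem genericCor_eq : genericCor 4 = corMatrix fun i => X (varEquiv i) := by
  ext i j : 2
  fin_cases i <;> fin_cases j <;> simp [genericCor, corMatrix, varEquiv]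

theorem ciIdeal_eq_comap_maskIdeal (L : CIRelation 4) (v : ℕ)
    (hv : ∀ n : Fin 24, v.testBit n = true ↔ couple n ∈ L) :
    L.ciIdeal = (maskIdeal v).comap (renameEquiv ℝ varEquiv).toRingEquiv.symm := by
  rw [Ideal.comap_symm, maskIdeal, Ideal.map_span, CIRelation.ciIdeal]
  congr 1
  ext g
  constructor
  · rintro ⟨c, hc, rfl⟩
    obtain ⟨n, rfl⟩ := exists_couple_eq c
    refine ⟨_, ⟨n, (hv n).2 hc, rfl⟩, ?_⟩
    rw [genericCor_eq, minor_couple, map_coupleMinor]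
    congr 1
    funext i
    simp
  · rintro ⟨_, ⟨n, hn, rfl⟩, rfl⟩
    refine ⟨_, (hv n).1 hn, ?_⟩
    rw [genericCor_eq, minor_couple, map_coupleMinor]
    congr 1
    funext i
    simp

theorem exists_mask (P : Fin 24 → Prop) :
    ∃ v : ℕ, v < 2 ^ 24 ∧ ∀ n : Fin 24, v.testBit n = true ↔ P n := by
  classical
  refine ⟨Nat.ofBits fun n => decide (P n), Nat.ofBits_lt_two_pow _, fun n => ?_⟩
  simp [Nat.testBit_ofBits_lt]

/-! ### Reduction to correlation matrices -/

theorem CICouple.minor_scale {m : ℕ} {R : Type*} [CommRing R] (c : CICouple m)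
    (M : Matrix (Fin m) (Fin m) R) (d : Fin m → R) :
    c.minor (Matrix.of fun i j => d i * (d j * M i j)) =
      (d c.i * ∏ k : {k // k ∈ c.C}, d k) * ((d c.j * ∏ k : {k // k ∈ c.C}, d k) * c.minor M) := by
  rw [CICouple.minor, CICouple.minor]
  let r : Unit ⊕ {k : Fin m // k ∈ c.C} → Fin m := Sum.elim (fun _ => c.i) fun k => k
  let s : Unit ⊕ {k : Fin m // k ∈ c.C} → Fin m := Sum.elim (fun _ => c.j) fun k => k
  have h1 := Matrix.det_mul_column (fun a => d (r a)) (Matrix.of fun a b => d (s b) * M (r a) (s b))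
  have h2 := Matrix.det_mul_row (fun b => d (s b)) (M.submatrix r s)
  rw [Fintype.prod_sum_type] at h1 h2
  simp only [r, s, Sum.elim_inl, Sum.elim_inr, Finset.univ_unique, Finset.prod_singleton] at h1 h2
  rw [← h2]
  exact h1

/-- Pass from `S` to `D S D` with `D` the diagonal matrix of the numbers `(√(S i i))⁻¹`. A
congruence keeps positive definiteness, and each minor is multiplied by a nonzero factor. -/
theorem exists_corMatrix_of_posDef (S : Matrix (Fin 4) (Fin 4) ℝ) (hS : S.PosDef) :
    ∃ x : Fin 6 → ℝ, (corMatrix x).PosDef ∧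
      ∀ n : Fin 24, coupleMinor n x = 0 ↔ (couple n).minor S = 0 := by
  let d : Fin 4 → ℝ := fun i => (√(S i i))⁻¹
  have hd : ∀ i, 0 < d i := fun i => inv_pos.2 (Real.sqrt_pos.2 hS.diag_pos)
  have hdS : ∀ i, d i * (d i * S i i) = 1 := fun i => by
    have h := Real.mul_self_sqrt (hS.diag_pos (i := i)).le
    have h0 := (Real.sqrt_pos.2 (hS.diag_pos (i := i))).ne'
    simp only [d]
    field_simp
    nlinarith
  have hsymm : ∀ i j, S i j = S j i := fun i j => by
    simpa using (hS.isHermitian.apply i j).symm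
  obtain ⟨x, hM⟩ : ∃ x, (Matrix.of fun i j => d i * (d j * S i j)) = corMatrix x := by
    use ![d 0 * (d 1 * S 0 1), d 0 * (d 2 * S 0 2), d 0 * (d 3 * S 0 3),
      d 1 * (d 2 * S 1 2), d 1 * (d 3 * S 1 3), d 2 * (d 3 * S 2 3)]
    ext i j
    fin_cases i <;> fin_cases j <;> simp [corMatrix, hdS, hsymm 1 0, hsymm 2 0, hsymm 3 0, hsymm 2 1, hsymm 3 1, hsymm 3 2] <;>
      ring
  refine ⟨x, ?_, fun n => ?_⟩
  rotate_left
  · rw [← minor_couple, ← hM, CICouple.minor_scale]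
    have h : ∀ i, d i ≠ 0 := fun i => (hd i).ne'
    simp [h, Finset.prod_eq_zero_iff]
  · rw [← hM]
    have h := hS.mul_mul_conjTranspose_same (B := Matrix.diagonal d) (by
      intro v w hvw
      funext i
      have := congrFun hvw i
      simpa [Matrix.vecMul_diagonal, (hd i).ne'] using this)
    convert h using 1
    ext i j
    simp [Matrix.diagonal_mul, Matrix.mul_diagonal]
    ring

/-! ### Enumeration of the gaussoids on four elements up to symmetry -/

/-- The permutations of the numbers of the couples that are induced by the adjacent transpositions
of `[4]`. -/
def swapNo : Fin 3 → Fin 24 → Fin 24 :=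
  ![![0, 1, 2, 3, 12, 13, 14, 15, 16, 17, 18, 19, 4, 5, 6, 7, 8, 9, 10, 11, 20, 22, 21, 23],
    ![4, 5, 6, 7, 0, 1, 2, 3, 8, 10, 9, 11, 12, 13, 14, 15, 20, 21, 22, 23, 16, 17, 18, 19],
    ![0, 2, 1, 3, 8, 9, 10, 11, 4, 5, 6, 7, 16, 17, 18, 19, 12, 13, 14, 15, 20, 21, 22, 23]]

/-- The permutations `swapNo` of the binary digits, as shifts of blocks. -/
def swapDigits (k : Fin 3) (v : ℕ) : ℕ :=
  -- The digits in `f` stay, those in `u` move up and those in `d` down by `s` places, and those in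
  -- `p` trade places with their upper neighbours.
  let b (f u d s p : ℕ) : ℕ :=
    Nat.lor (Nat.lor (Nat.land v f) (Nat.shiftLeft (Nat.land v u) s))
      (Nat.lor (Nat.shiftRight (Nat.land v d) s)
        (Nat.lor (Nat.shiftLeft (Nat.land v p) 1) (Nat.shiftRight (Nat.land v (2 * p)) 1)))
  match k with
  | 0 => b 0x90000F 0xFF0 0xFF000 8 0x200000
  | 1 => b 0x00F900 0xF000F 0xF000F0 4 0x200
  | 2 => b 0xF00009 0xF0F0 0xF0F00 4 0x2

/-- A Hamiltonian path of the Cayley graph of `S₄` for the adjacent transpositions. -/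
def swapPath : List (Fin 3) :=
  [0, 1, 0, 1, 0, 2, 0, 1, 0, 1, 0, 2, 0, 1, 2, 1, 0, 1, 0, 1, 2, 1, 0]

/-- Representatives of the orbits of the relations with the gaussoid property; the binary digits of
an entry are the indicator of the numbers of its couples. -/
def gaussoidMasks : List ℕ :=
  [0, 1, 2, 8, 6, 9, 20, 24, 36, 40, 4352, 4608, 6144, 8704, 10240, 34816, 296, 578, 4360, 4616,
  4672, 5632, 6148, 6400, 8712, 8768, 9728, 10244, 10496, 16912, 18433, 26624, 34817, 35072, 51,
  204, 26112, 26880, 39168, 74880, 75840, 100368, 148512, 4300, 8396, 12340, 12344, 12339,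
  49356, 13063, 15024, 51936, 4095, 16383, 53247, 1048560, 1048575, 16777215]

/-- Whether the least number on a path from `v`, or the bound `u`, is in the list. -/
def reaches (l : List ℕ) : List (Fin 3) → ℕ → ℕ → Bool
  | [], _, u => l.any (Nat.beq u)
  | k :: ks, v, u =>
    cond (Nat.ble u (swapDigits k v)) (reaches l ks (swapDigits k v) u)
      (reaches l ks (swapDigits k v) (swapDigits k v))

/-- The numbers of the couples `ij`, `ij|k`, `ij|l`, `ij|kl` for `{i, j, k, l} = [4]`. -/
def coupleNo (i j k l : Fin 4) : Fin 4 → ℕ :=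
  let p : ℕ := 4 * (![![0, 0, 1, 2], ![0, 0, 3, 4], ![1, 3, 0, 5], ![2, 4, 5, 0]] : Fin 4 → Fin 4 → ℕ) i j
  -- In each block of four the couple conditioned on the smaller remaining element comes first. The
  -- diagonal zeros of the table are fillers, since `i ≠ j`.
  ![p, if k < l then p + 1 else p + 2, if k < l then p + 2 else p + 1, p + 3]

/-- The numbers of four couples `(a, b, c, d)` stand for the implication `a ∧ b → c ∨ d`; these are
the gaussoid axioms for a fixed ordering of `[4]`. -/
def axiomsAt (i j k l : Fin 4) : List (ℕ × ℕ × ℕ × ℕ) :=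
  let ij := coupleNo i j k l
  let ik := coupleNo i k j l
  let jk := coupleNo j k i l
  [(ij 0, ik 1, ik 0, ik 0), (ij 0, ik 1, ij 1, ij 1), (ij 1, ik 1, ij 0, ij 0),
    (ij 0, ik 0, ij 1, ij 1), (ij 0, ij 1, ik 0, jk 0),
    (ij 2, ik 3, ik 2, ik 2), (ij 2, ik 3, ij 3, ij 3), (ij 3, ik 3, ij 2, ij 2),
    (ij 2, ik 2, ij 3, ij 3), (ij 2, ij 3, ik 2, jk 2)]

def orderings : List (Fin 4 × Fin 4 × Fin 4 × Fin 4) :=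
  [(0, 1, 2, 3), (0, 1, 3, 2), (0, 2, 1, 3), (0, 2, 3, 1), (0, 3, 1, 2), (0, 3, 2, 1),
    (1, 0, 2, 3), (1, 0, 3, 2), (1, 2, 0, 3), (1, 2, 3, 0), (1, 3, 0, 2), (1, 3, 2, 0),
    (2, 0, 1, 3), (2, 0, 3, 1), (2, 1, 0, 3), (2, 1, 3, 0), (2, 3, 0, 1), (2, 3, 1, 0),
    (3, 0, 1, 2), (3, 0, 2, 1), (3, 1, 0, 2), (3, 1, 2, 0), (3, 2, 0, 1), (3, 2, 1, 0)]

def gaussoidAxioms : List (ℕ × ℕ × ℕ × ℕ) :=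
  orderings.flatMap fun t => axiomsAt t.1 t.2.1 t.2.2.1 t.2.2.2

/-- The digit number `n` of `v`. -/
def digit (v n : ℕ) : Bool := Nat.beq (Nat.mod (Nat.shiftRight v n) 2) 1

def implHolds (v : ℕ) (t : ℕ × ℕ × ℕ × ℕ) : Bool :=
  cond (digit v t.1) (cond (digit v t.2.1) (or (digit v t.2.2.1) (digit v t.2.2.2)) true) true

/-- These axioms become decidable exactly when digit `n` has been chosen, so that the search can cut
a branch there. -/
def axiomLevel (n : ℕ) : List (ℕ × ℕ × ℕ × ℕ) :=
  gaussoidAxioms.filter fun t => Nat.beq (max (max t.1 t.2.1) (max t.2.2.1 t.2.2.2)) n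

/-- Search through the extensions of the digits `v < w` by further digits, one for each list of
implications. -/
def search (F : ℕ → Bool) : List (List (ℕ × ℕ × ℕ × ℕ)) → ℕ → ℕ → Bool
  | [], v, _ => F v
  | c :: cs, v, w =>
    (!(c.all (implHolds v)) || search F cs v (2 * w)) &&
      (!(c.all (implHolds (v + w))) || search F cs (v + w) (2 * w))

/-- Cutting at the first violated axiom keeps the binary tree of depth 24 small. At each leaf
`reaches` walks through all 24 relabellings and looks up the least number of the orbit in the list.
-/
theorem search_gaussoids :
    search (fun v => reaches gaussoidMasks swapPath v v) ((List.range' 0 24).map axiomLevel) 0 1 = true := by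
  decide +kernel

theorem digit_eq_testBit (v n : ℕ) : digit v n = v.testBit n := by
  rw [Bool.eq_iff_iff, Nat.testBit_eq_decide_div_mod_eq, decide_eq_true_iff, ← Nat.shiftRight_eq_div_pow]
  exact iff_of_eq Nat.beq_eq

theorem implHolds_iff (v : ℕ) (t : ℕ × ℕ × ℕ × ℕ) : implHolds v t = true ↔
    (v.testBit t.1 = true → v.testBit t.2.1 = true →
      v.testBit t.2.2.1 = true ∨ v.testBit t.2.2.2 = true) := by
  unfold implHolds
  simp only [digit_eq_testBit]
  cases v.testBit t.1 <;> cases v.testBit t.2.1 <;> simp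

/-- The branch of `m` passes at depth `n` through `m % 2 ^ n`. It is never cut, because the axioms
of level `n` only see digits up to `n`, which this node shares with `m`. -/
theorem search_sound (F : ℕ → Bool) (m : ℕ) (level : ℕ → List (ℕ × ℕ × ℕ × ℕ))
    (hc : ∀ k, ∀ t ∈ level k, implHolds m t = true ∧
      t.1 ≤ k ∧ t.2.1 ≤ k ∧ t.2.2.1 ≤ k ∧ t.2.2.2 ≤ k) (l n : ℕ) (hm : m < 2 ^ (n + l))
    (h : search F ((List.range' n l).map level) (m % 2 ^ n) (2 ^ n) = true) : F m = true := by
  induction l generalizing n with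
  | zero =>
    rw [List.range'_zero, List.map_nil, search, Nat.mod_eq_of_lt (by simpa using hm)] at h
    exact h
  | succ l ih =>
    have hall : (level n).all (implHolds (m % 2 ^ (n + 1))) = true := by
      rw [List.all_eq_true]
      intro t ht
      obtain ⟨h1, h2, h3, h4, h5⟩ := hc n t ht
      rw [implHolds_iff] at h1 ⊢
      simp only [Nat.testBit_mod_two_pow, Bool.and_eq_true, decide_eq_true_eq]
      have : ∀ a, a ≤ n → a < n + 1 := fun a ha => Nat.lt_succ_of_le ha
      simp only [this _ h2, this _ h3, this _ h4, this _ h5, true_and]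
      exact h1
    refine ih (n + 1) (by convert hm using 2; omega) ?_
    rw [List.range'_succ, List.map_cons, search, Bool.and_eq_true] at h
    have hp : 2 * 2 ^ n = 2 ^ (n + 1) := by ring
    have hmod : m % 2 ^ (n + 1) = m % 2 ^ n + 2 ^ n * (m / 2 ^ n % 2) := Nat.mod_pow_succ
    rcases Nat.mod_two_eq_zero_or_one (m / 2 ^ n) with hb | hb
    · rw [hb, mul_zero, add_zero] at hmod
      have h2 := h.1
      rw [← hmod, hall, hp] at h2
      simpa using h2
    · rw [hb, mul_one] at hmod
      have h2 := h.2
      rw [← hmod, hall, hp] at h2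
      simpa using h2

theorem mem_axiomLevel (k : ℕ) (t : ℕ × ℕ × ℕ × ℕ) (ht : t ∈ axiomLevel k) :
    t ∈ gaussoidAxioms ∧ t.1 ≤ k ∧ t.2.1 ≤ k ∧ t.2.2.1 ≤ k ∧ t.2.2.2 ≤ k := by
  obtain ⟨h1, h2⟩ := List.mem_filter.1 ht
  have := Nat.eq_of_beq_eq_true h2
  refine ⟨h1, ?_⟩
  omega

/-- The listed number is either the initial bound `u` or a number met on the path; in the second
case `P` is carried back along the path to `v`. -/
theorem reaches_sound (P : ℕ → Prop) (l : List ℕ) (hl : ∀ v ∈ l, P v)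
    (hP : ∀ k v, P (swapDigits k v) → P v) (p : List (Fin 3)) (v u : ℕ)
    (h : reaches l p v u = true) : P v ∨ P u := by
  induction p generalizing v u with
  | nil =>
    rw [reaches, List.any_eq_true] at h
    obtain ⟨w, hw, hw'⟩ := h
    rw [Nat.eq_of_beq_eq_true hw']
    exact Or.inr (hl w hw)
  | cons k ks ih =>
    rw [reaches] at h
    cases hb : Nat.ble u (swapDigits k v) <;> rw [hb] at h
    · exact Or.inl (hP k v ((ih _ _ h).elim id id))
    · exact (ih _ _ h).imp (hP k v) id

/-- A property of relations that is invariant under permutations of `[4]` and holds for the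
representatives holds for all the relations that have the gaussoid property. -/
theorem gaussoid_induction (P : ℕ → Prop) (hl : ∀ v ∈ gaussoidMasks, P v)
    (hP : ∀ k v, P (swapDigits k v) → P v) (v : ℕ) (hv : v < 2 ^ 24)
    (hax : ∀ t ∈ gaussoidAxioms, v.testBit t.1 = true → v.testBit t.2.1 = true →
      v.testBit t.2.2.1 = true ∨ v.testBit t.2.2.2 = true) : P v := by
  have h := search_sound (fun v => reaches gaussoidMasks swapPath v v) v axiomLevel
    (fun k t ht => ⟨(implHolds_iff _ _).2 (hax t (mem_axiomLevel k t ht).1),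
      (mem_axiomLevel k t ht).2⟩) 24 0 hv (by
      rw [pow_zero, Nat.mod_one]
      exact search_gaussoids)
  exact (reaches_sound P _ hl hP _ _ _ h).elim id id

/-! ### Positive definite matrices satisfy the gaussoid axioms -/

/-- The last formula is the minor of `ij|k` in the Schur complement of the entry `l`. Conditioning
on `l` thus amounts to passing to a 3 × 3 matrix whose diagonal is no longer 1. -/
theorem coupleMinor_coupleNo {B : Type*} [CommRing B] (x : Fin 6 → B) (i j k l : Fin 4)
    (h : i ≠ j ∧ i ≠ k ∧ i ≠ l ∧ j ≠ k ∧ j ≠ l ∧ k ≠ l) :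
    let e := corMatrix x
    coupleMinor (coupleNo i j k l 0) x = e i j ∧
    coupleMinor (coupleNo i j k l 1) x = e i j - e i k * e j k ∧
    coupleMinor (coupleNo i j k l 2) x = e i j - e i l * e j l ∧
    coupleMinor (coupleNo i j k l 3) x =
      (e i j - e i l * e j l) * (1 - e k l * e k l) -
        (e i k - e i l * e k l) * (e j k - e j l * e k l) := by
  fin_cases i <;> fin_cases j <;> try exact absurd h (by decide)
  all_goals fin_cases k <;> try exact absurd h (by decide)
  all_goals fin_cases l <;> try exact absurd h (by decide)
  all_goals
    refine ⟨?_, ?_, ?_, ?_⟩ <;> simp [coupleNo, corMatrix, coupleMinor]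
  all_goals ring

theorem corMatrix_symm {B : Type*} [CommRing B] (x : Fin 6 → B) (i j : Fin 4) :
    corMatrix x i j = corMatrix x j i := by
  fin_cases i <;> fin_cases j <;> rfl

theorem corMatrix_diag {B : Type*} [CommRing B] (x : Fin 6 → B) (i : Fin 4) :
    corMatrix x i i = 1 := by
  fin_cases i <;> rfl

theorem Matrix.PosDef.two_minor_pos {x : Fin 6 → ℝ} (hx : (corMatrix x).PosDef) (i j : Fin 4)
    (h : i ≠ j) : 0 < 1 - corMatrix x i j * corMatrix x i j := by
  have := (hx.submatrix (e := ![i, j]) (by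
    intro a b; fin_cases a <;> fin_cases b <;> simp [h, h.symm])).det_pos
  rw [Matrix.det_fin_two] at this
  simpa [corMatrix_diag, corMatrix_symm x j i] using this

theorem Matrix.PosDef.three_minor_pos {x : Fin 6 → ℝ} (hx : (corMatrix x).PosDef)
    (i j l : Fin 4) (hij : i ≠ j) (hil : i ≠ l) (hjl : j ≠ l) :
    let e := corMatrix x
    0 < (1 - e i l * e i l) * (1 - e j l * e j l) -
      (e i j - e i l * e j l) * (e i j - e i l * e j l) := by
  have := (hx.submatrix (e := ![i, j, l]) (by
    intro a b
    fin_cases a <;> fin_cases b <;> simp [hij, hij.symm, hil, hil.symm, hjl, hjl.symm])).det_pos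
  rw [Matrix.det_fin_three] at this
  simp [corMatrix_diag, corMatrix_symm x j i, corMatrix_symm x l i, corMatrix_symm x l j] at this
  intro e
  simp only [e]
  linarith

/-- The gaussoid axioms of a `3 × 3` matrix with diagonal
entries `p, q, r`, off-diagonal entries `a, b, c` and positive principal minors. -/
theorem gaussoid_axioms_three {q r a b c : ℝ} (hq : 0 < q) (hqr : 0 < q * r - c * c) :
    (a = 0 → b * q - a * c = 0 → b = 0) ∧ (a = 0 → b * q - a * c = 0 → a * r - b * c = 0) ∧
    (a * r - b * c = 0 → b * q - a * c = 0 → a = 0) ∧ (a = 0 → b = 0 → a * r - b * c = 0) ∧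
    (a = 0 → a * r - b * c = 0 → b = 0 ∨ c = 0) := by
  have h1 : a = 0 → b * q - a * c = 0 → b = 0 := by
    rintro rfl h
    have : b * q = 0 := by linear_combination h
    exact (mul_eq_zero.1 this).resolve_right hq.ne'
  refine ⟨h1, fun ha h => ?_, fun h h' => ?_, ?_, ?_⟩
  · rw [ha, h1 ha h]; ring
  · have : a * (q * r - c * c) = 0 := by linear_combination q * h + c * h'
    exact (mul_eq_zero.1 this).resolve_right hqr.ne'
  · rintro rfl rfl; ring
  · rintro rfl h
    have : b * c = 0 := by linear_combination -h
    exact mul_eq_zero.1 this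

theorem gaussoidAxioms_of_posDef (x : Fin 6 → ℝ) (hx : (corMatrix x).PosDef)
    (t : ℕ × ℕ × ℕ × ℕ) (ht : t ∈ gaussoidAxioms) (h1 : coupleMinor t.1 x = 0)
    (h2 : coupleMinor t.2.1 x = 0) :
    coupleMinor t.2.2.1 x = 0 ∨ coupleMinor t.2.2.2 x = 0 := by
  obtain ⟨⟨i, j, k, l⟩, ho, ht⟩ := List.mem_flatMap.1 ht
  have hd : ∀ o ∈ orderings, o.1 ≠ o.2.1 ∧ o.1 ≠ o.2.2.1 ∧ o.1 ≠ o.2.2.2 ∧ o.2.1 ≠ o.2.2.1 ∧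
    o.2.1 ≠ o.2.2.2 ∧ o.2.2.1 ≠ o.2.2.2 := by decide +kernel
  obtain ⟨hij, hik, hil, hjk, hjl, hkl⟩ := hd _ ho
  dsimp only at hij hik hil hjk hjl hkl ht
  obtain ⟨a0, a1, a2, a3⟩ := coupleMinor_coupleNo x i j k l ⟨hij, hik, hil, hjk, hjl, hkl⟩
  obtain ⟨b0, b1, b2, b3⟩ := coupleMinor_coupleNo x i k j l ⟨hik, hij, hil, hjk.symm, hkl, hjl⟩
  obtain ⟨c0, c1, c2, c3⟩ := coupleMinor_coupleNo x j k i l ⟨hjk, hij.symm, hjl, hik.symm, hkl, hil⟩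
  rw [corMatrix_symm x k j] at b1 b3
  rw [mul_comm (corMatrix x k l) (corMatrix x j l)] at b3
  -- The `e`s concern the principal submatrix on `i, j, k`, the `f`s the Schur complement of `l`,
  -- whose 2 × 2 minor is a 3 × 3 principal minor of the original matrix.
  obtain ⟨e1, e2, e3, e4, e5⟩ := gaussoid_axioms_three (a := corMatrix x i j)
    (b := corMatrix x i k) one_pos (by simpa using hx.two_minor_pos j k hjk)
  obtain ⟨f1, f2, f3, f4, f5⟩ := gaussoid_axioms_three
    (a := corMatrix x i j - corMatrix x i l * corMatrix x j l)
    (b := corMatrix x i k - corMatrix x i l * corMatrix x k l)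
    (hx.two_minor_pos j l hjl) (hx.three_minor_pos j k l hjk hjl hkl)
  simp only [mul_one] at e1 e2 e3 e4 e5
  simp only [axiomsAt, List.mem_cons, List.not_mem_nil, or_false] at ht
  rcases ht with rfl | rfl | rfl | rfl | rfl | rfl | rfl | rfl | rfl | rfl <;>
    simp only [a0, a1, a2, a3, b0, b1, b2, b3, c0, c2, or_self] at h1 h2 ⊢
  exacts [e1 h1 h2, e2 h1 h2, e3 h1 h2, e4 h1 h2, e5 h1 h2, f1 h1 h2, f2 h1 h2, f3 h1 h2,
    f4 h1 h2, f5 h1 h2]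

/-! ### Invariance under relabelling and reduction to the representatives -/

/-- The permutations of the variables that are induced by the adjacent transpositions of `[4]`. -/
def swapVar : Fin 3 → Fin 6 → Fin 6 :=
  ![![0, 3, 4, 1, 2, 5], ![1, 0, 2, 3, 5, 4], ![0, 2, 1, 4, 3, 5]]

theorem swapVar_swapVar (k : Fin 3) (i : Fin 6) : swapVar k (swapVar k i) = i := by
  revert k i
  decide

theorem swapNo_swapNo (k : Fin 3) (n : Fin 24) : swapNo k (swapNo k n) = n := by
  revert k n
  decide +kernel

theorem coupleMinor_swapNo {B : Type*} [CommRing B] (k : Fin 3) (n : Fin 24) (x : Fin 6 → B) :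
    coupleMinor (swapNo k n) x = coupleMinor n fun i => x (swapVar k i) := by
  fin_cases k <;> fin_cases n <;> simp [swapNo, swapVar, coupleMinor] <;> ring

theorem testBit_swapDigits (k : Fin 3) (v : ℕ) (n : Fin 24) :
    (swapDigits k v).testBit n = v.testBit (swapNo k n) := by
  have h1 : ∀ a b, Nat.lor a b = a ||| b := fun _ _ => rfl
  have h2 : ∀ a b, Nat.land a b = a &&& b := fun _ _ => rfl
  have h3 : ∀ a b, Nat.shiftLeft a b = a <<< b := fun _ _ => rfl
  have h4 : ∀ a b, Nat.shiftRight a b = a >>> b := fun _ _ => rfl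
  fin_cases k <;>
    simp only [swapDigits, h1, h2, h3, h4, Nat.testBit_or, Nat.testBit_and,
      Nat.testBit_shiftLeft, Nat.testBit_shiftRight] <;>
    fin_cases n <;> simp [swapNo, Nat.testBit_eq_decide_div_mod_eq]

theorem corMatrix_posDef_swap (k : Fin 3) (x : Fin 6 → ℝ) (hx : (corMatrix x).PosDef) :
    (corMatrix fun i => x (swapVar k i)).PosDef := by
  let e : Fin 3 → Fin 4 → Fin 4 := ![![1, 0, 2, 3], ![0, 2, 1, 3], ![0, 1, 3, 2]]
  have he : ∀ k, Function.Injective (e k) := by decide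
  convert hx.submatrix (he k) using 1
  ext i j
  fin_cases k <;> fin_cases i <;> fin_cases j <;> simp [e, corMatrix, swapVar]

/-- If `v` is the relation of a positive definite matrix, then its ideal is radical. -/
def RadicalIfRepresentable (v : ℕ) : Prop :=
  ∀ x : Fin 6 → ℝ, (corMatrix x).PosDef →
    (∀ n : Fin 24, v.testBit n = true ↔ coupleMinor n x = 0) → (maskIdeal v).IsRadical

/-- Renaming the variables by `swapVar k` is an involution that exchanges the two ideals, and
preimages of radical ideals are radical. -/
theorem radicalIfRepresentable_of_swapDigits (k : Fin 3) (v : ℕ)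
    (h : RadicalIfRepresentable (swapDigits k v)) : RadicalIfRepresentable v := by
  intro x hx hv
  have hr := h (fun i => x (swapVar k i)) (corMatrix_posDef_swap k x hx) fun n => by
    rw [testBit_swapDigits, ← coupleMinor_swapNo, hv]
  let φ : MvPolynomial (Fin 6) ℝ →ₐ[ℝ] MvPolynomial (Fin 6) ℝ := rename (swapVar k)
  have hφ : ∀ g, φ (φ g) = g := fun g => by
    simp only [φ, rename_rename]
    convert rename_id_apply g using 2
    exact congrArg rename (funext (swapVar_swapVar k))
  have hmap : ∀ n : Fin 24, φ (coupleMinor n X) = coupleMinor (swapNo k n) X := fun n => by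
    rw [map_coupleMinor, coupleMinor_swapNo]
    simp [φ]
  have hle : ∀ u w : ℕ, (∀ n : Fin 24, u.testBit n = true → w.testBit (swapNo k n) = true) →
      maskIdeal u ≤ (maskIdeal w).comap φ := fun u w huw => by
    rw [maskIdeal, Ideal.span_le]
    rintro _ ⟨n, hn, rfl⟩
    exact Ideal.subset_span ⟨swapNo k n, huw n hn, hmap n⟩
  have heq : maskIdeal v = (maskIdeal (swapDigits k v)).comap φ := by
    refine le_antisymm (hle _ _ fun n hn => ?_) fun g hg => ?_
    · rwa [testBit_swapDigits, swapNo_swapNo]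
    · have := hle (swapDigits k v) v (fun n hn => by rwa [testBit_swapDigits] at hn) hg
      rwa [Ideal.mem_comap, hφ] at this
  rw [heq]
  exact hr.comap φ

theorem ciIdeal_isRadical_of_representable (hgood : ∀ v ∈ gaussoidMasks, RadicalIfRepresentable v)
    (L : CIRelation 4) (hL : L.Representable) : L.ciIdeal.IsRadical := by
  obtain ⟨S, hS, hSL⟩ := hL
  obtain ⟨x, hx, hxS⟩ := exists_corMatrix_of_posDef S hS
  obtain ⟨v, hv, hvL⟩ := exists_mask fun n => couple n ∈ L
  have hvx : ∀ n : Fin 24, v.testBit n = true ↔ coupleMinor n x = 0 := fun n => by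
    rw [hvL, hxS, hSL]
  rw [ciIdeal_eq_comap_maskIdeal L v hvL]
  refine Ideal.IsRadical.comap _ (gaussoid_induction RadicalIfRepresentable hgood
    radicalIfRepresentable_of_swapDigits v hv (fun t ht h1 h2 => ?_) x hx hvx)
  have hlt : ∀ t ∈ gaussoidAxioms, t.1 < 24 ∧ t.2.1 < 24 ∧ t.2.2.1 < 24 ∧ t.2.2.2 < 24 := by
    decide +kernel
  obtain ⟨l1, l2, l3, l4⟩ := hlt t ht
  have := gaussoidAxioms_of_posDef x hx t ht ((hvx ⟨_, l1⟩).1 h1) ((hvx ⟨_, l2⟩).1 h2)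
  exact this.imp (hvx ⟨_, l3⟩).2 (hvx ⟨_, l4⟩).2

/-! ### Squarefreeness by restriction to a line -/

/-- The polynomial with the given coefficients and monomials. -/
noncomputable def ofTerms (l : List (ℤ × List (Fin 6))) : MvPolynomial (Fin 6) ℝ :=
  (l.map fun t => (t.1 : MvPolynomial (Fin 6) ℝ) * (t.2.map X).prod).sum

theorem totalDegree_ofTerms_le (n : ℕ) (l : List (ℤ × List (Fin 6)))
    (h : ∀ t ∈ l, t.2.length ≤ n) : (ofTerms l).totalDegree ≤ n := by
  induction l with
  | nil => simp [ofTerms]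
  | cons t l ih =>
    have h1 : ofTerms (t :: l) = C (t.1 : ℝ) * (t.2.map X).prod + ofTerms l := by
      simp [ofTerms]
    have h2 : ∀ s : List (Fin 6),
        (s.map (X : Fin 6 → MvPolynomial (Fin 6) ℝ)).prod.totalDegree ≤ s.length := fun s => by
      induction s with
      | nil => simp
      | cons i s ih =>
        rw [List.map_cons, List.prod_cons, List.length_cons]
        refine (totalDegree_mul _ _).trans ?_
        rw [totalDegree_X]
        omega
    rw [h1]
    refine (totalDegree_add _ _).trans (max_le ?_ (ih fun s hs => h s (List.mem_cons_of_mem _ hs)))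
    refine (totalDegree_mul _ _).trans ?_
    rw [totalDegree_C, zero_add]
    exact (h2 _).trans (h t List.mem_cons_self)

/-- A polynomial is squarefree if its restriction to some line is separable and has no smaller
degree. -/
theorem squarefree_of_line {g : MvPolynomial (Fin 6) ℝ} {n : ℕ} (hg : g.totalDegree ≤ n)
    (a v : Fin 6 → ℤ) {h : Polynomial ℝ}
    (hh : aeval (fun i => (a i : Polynomial ℝ) + (v i : Polynomial ℝ) * Polynomial.X) g = h)
    (hn : n ≤ h.natDegree) (hs : Squarefree h) : Squarefree g := by
  set ℓ : Fin 6 → Polynomial ℝ := fun i => (a i : Polynomial ℝ) + (v i : Polynomial ℝ) * Polynomial.X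
  have hℓ : ∀ i, (ℓ i).natDegree ≤ 1 := fun i => by simp only [ℓ]; compute_degree
  have hdeg : ∀ p : MvPolynomial (Fin 6) ℝ, (aeval ℓ p).natDegree ≤ p.totalDegree := fun p => by
    simpa using aeval_natDegree_le p le_rfl ℓ hℓ
  rintro p ⟨q, rfl⟩
  have h0 : h ≠ 0 := hs.ne_zero
  rw [map_mul, map_mul] at hh
  have hP : aeval ℓ p ≠ 0 := by rintro h1; rw [h1] at hh; simp [← hh] at h0
  have hQ : aeval ℓ q ≠ 0 := by rintro h1; rw [h1] at hh; simp [← hh] at h0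
  have hp : p ≠ 0 := by rintro rfl; simp at hP
  have hq : q ≠ 0 := by rintro rfl; simp at hQ
  rw [totalDegree_mul_of_isDomain (mul_ne_zero hp hp) hq, totalDegree_mul_of_isDomain hp hp] at hg
  -- If `p * p` divides `g`, then `p` restricts to a unit, so only `q` contributes to the degree on
  -- the line. This degree is at least `n`, which leaves degree 0 for `p`.
  have hu : IsUnit (aeval ℓ p) := hs _ ⟨_, hh.symm⟩
  rw [← hh, Polynomial.natDegree_mul (mul_ne_zero hP hP) hQ, Polynomial.natDegree_mul hP hP,
    Polynomial.natDegree_eq_zero_of_isUnit hu] at hn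
  have := hdeg q
  have hp0 : p.totalDegree = 0 := by omega
  rw [totalDegree_eq_zero_iff_eq_C] at hp0
  rw [hp0] at hp ⊢
  exact (isUnit_iff_ne_zero.2 fun h => hp (by rw [h, C_0])).map C

theorem squarefree_of_bezout {h : Polynomial ℝ} (u v : Polynomial ℝ) (k : ℤ) (hk : k ≠ 0)
    (hb : u * h + v * h.derivative = k) : Squarefree h := by
  refine Polynomial.Separable.squarefree ⟨Polynomial.C (k : ℝ)⁻¹ * u, Polynomial.C (k : ℝ)⁻¹ * v, ?_⟩
  rw [mul_assoc, mul_assoc, ← mul_add, hb, ← map_intCast (Polynomial.C : ℝ →+* _),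
    ← Polynomial.C_mul, inv_mul_cancel₀ (by exact_mod_cast hk), Polynomial.C_1]

theorem span_isRadical_of_squarefree {g : MvPolynomial (Fin 6) ℝ} (h : Squarefree g) :
    (Ideal.span {g}).IsRadical :=
  isRadical_iff_span_singleton.1 h.isRadical

/-! ### Elimination by substitution -/

theorem sub_mem_of_forall_X {I : Ideal (MvPolynomial (Fin 6) ℝ)}
    {φ : MvPolynomial (Fin 6) ℝ →ₐ[ℝ] MvPolynomial (Fin 6) ℝ} (hX : ∀ i, X i - φ (X i) ∈ I)
    (y : MvPolynomial (Fin 6) ℝ) : y - φ y ∈ I := by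
  have h : (Ideal.Quotient.mkₐ ℝ I).comp φ = Ideal.Quotient.mkₐ ℝ I :=
    algHom_ext fun i => (Ideal.Quotient.eq.2 (hX i)).symm
  exact Ideal.Quotient.eq.1 (congrArg (fun ψ => ψ y) h).symm

/-- Since `φ` is the identity modulo `I`, the hypotheses make `I` the preimage of `J` under `φ`. -/
theorem isRadical_of_substitution {I J : Ideal (MvPolynomial (Fin 6) ℝ)}
    (φ : MvPolynomial (Fin 6) ℝ →ₐ[ℝ] MvPolynomial (Fin 6) ℝ) (hJ : J.IsRadical) (hJI : J ≤ I)
    (hφ : I ≤ J.comap φ) (hX : ∀ i, X i - φ (X i) ∈ I) : I.IsRadical := by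
  rintro y ⟨n, hy⟩
  have h1 : φ y ∈ J := hJ ⟨n, by rw [← map_pow]; exact hφ hy⟩
  simpa using I.add_mem (sub_mem_of_forall_X hX y) (hJI h1)

/-- The residue classes of the variables form a universal point. Ideal membership thereby becomes
equational reasoning about elements of an arbitrary algebra. -/
theorem mem_maskIdeal {v : ℕ} {g : MvPolynomial (Fin 6) ℝ}
    (h : ∀ (B : Type) [CommRing B] [Algebra ℝ B] (x : Fin 6 → B),
      (∀ n : Fin 24, v.testBit n = true → coupleMinor n x = 0) → aeval x g = 0) :
    g ∈ maskIdeal v := by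
  rw [← Ideal.Quotient.eq_zero_iff_mem]
  refine (congrArg (fun ψ => ψ g) (aeval_unique (Ideal.Quotient.mkₐ ℝ (maskIdeal v)))).trans
    (h _ _ fun n hn => ?_)
  refine (map_coupleMinor (Ideal.Quotient.mkₐ ℝ (maskIdeal v)) n X).symm.trans ?_
  exact Ideal.Quotient.eq_zero_iff_mem.2 (Ideal.subset_span ⟨n, hn, rfl⟩)

theorem aeval_eq_zero_of_mem_maskIdeal {v : ℕ} {g : MvPolynomial (Fin 6) ℝ} (hg : g ∈ maskIdeal v)
    {B : Type} [CommRing B] [Algebra ℝ B] (x : Fin 6 → B)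
    (hx : ∀ n : Fin 24, v.testBit n = true → coupleMinor n x = 0) : aeval x g = 0 := by
  have h : maskIdeal v ≤ RingHom.ker (aeval x : MvPolynomial (Fin 6) ℝ →ₐ[ℝ] B) := by
    rw [maskIdeal, Ideal.span_le]
    rintro _ ⟨n, hn, rfl⟩
    change aeval x _ = 0
    rw [map_coupleMinor]
    simpa using hx n hn
  exact h hg

/-- Elimination of variables: the relations `s` allow to replace the variables by polynomials `p`,
and what remains of the ideal is spanned by `G`. -/
theorem maskIdeal_isRadical_of_elimination {v : ℕ} (s : List ℕ) (p : Fin 6 → MvPolynomial (Fin 6) ℝ)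
    (G : Set (MvPolynomial (Fin 6) ℝ)) (hv : ∀ n : Fin 24, v.testBit n = s.contains n.1)
    (hs : ∀ n ∈ s, n < 24) (hG : (Ideal.span G).IsRadical)
    (hx : ∀ (B : Type) [CommRing B] [Algebra ℝ B] (x : Fin 6 → B),
      (∀ n ∈ s, coupleMinor n x = 0) → (∀ i, x i = aeval x (p i)) ∧ ∀ g ∈ G, aeval x g = 0)
    (hp : ∀ n ∈ s, coupleMinor n p ∈ Ideal.span G) : (maskIdeal v).IsRadical := by
  have hx' : ∀ (B : Type) [CommRing B] [Algebra ℝ B] (x : Fin 6 → B),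
      (∀ n : Fin 24, v.testBit n = true → coupleMinor n x = 0) →
        (∀ i, x i = aeval x (p i)) ∧ ∀ g ∈ G, aeval x g = 0 := fun B _ _ x h =>
    hx B x fun n hn => h ⟨n, hs n hn⟩ (by rw [hv]; simpa using hn)
  refine isRadical_of_substitution (aeval p) hG ?_ ?_ fun i => mem_maskIdeal fun B _ _ x h => ?_
  · rw [Ideal.span_le]
    exact fun g hg => mem_maskIdeal fun B _ _ x h => (hx' B x h).2 g hg
  · rw [maskIdeal, Ideal.span_le]
    rintro _ ⟨n, hn, rfl⟩
    rw [hv] at hn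
    change (aeval p : MvPolynomial (Fin 6) ℝ →ₐ[ℝ] _) _ ∈ Ideal.span G
    rw [map_coupleMinor]
    simpa using hp n (by simpa using hn)
  · rw [aeval_X, map_sub, aeval_X, ← (hx' B x h).1 i, sub_self]

/-! ### Radicality of ideals with two generators -/

/-- If `S` is prime to `P` modulo `Q`, then `(PQ, S)` is the intersection of `(P, S)` and
`(Q, S)`. -/
theorem span_mul_isRadical {P Q S : MvPolynomial (Fin 6) ℝ}
    (τ : MvPolynomial (Fin 6) ℝ →ₐ[ℝ] MvPolynomial (Fin 6) ℝ) (hτQ : τ Q = 0)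
    (hτ : ∀ j, Q ∣ X j - τ (X j)) (hrel : IsRelPrime (τ S) (τ P))
    (h1 : (Ideal.span {P, S}).IsRadical) (h2 : (Ideal.span {Q, S}).IsRadical) :
    (Ideal.span {P * Q, S}).IsRadical := by
  have hmod : ∀ y, Q ∣ y - τ y := fun y => Ideal.mem_span_singleton.1
    (sub_mem_of_forall_X (fun j => Ideal.mem_span_singleton.2 (hτ j)) y)
  rintro y ⟨n, hy⟩
  obtain ⟨c, d, hcd⟩ := Ideal.mem_span_pair.1 hy
  obtain ⟨α, β, h⟩ := Ideal.mem_span_pair.1 (h1 ⟨n, Ideal.mem_span_pair.2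
    ⟨c * Q, d, by rw [← hcd]; ring⟩⟩)
  obtain ⟨γ, δ, h'⟩ := Ideal.mem_span_pair.1 (h2 ⟨n, Ideal.mem_span_pair.2
    ⟨c * P, d, by rw [← hcd]; ring⟩⟩)
  -- Compare `y = αP + βS = γQ + δS` modulo `Q`: coprimality makes `α` a multiple of `S` there,
  -- hence `αP` lies in `(PQ, S)`.
  have hτy : τ α * τ P = τ S * τ (δ - β) := by
    have := congrArg τ (h.trans h'.symm)
    simp only [map_add, map_mul, hτQ, mul_zero, zero_add, map_sub] at this ⊢
    linear_combination this
  obtain ⟨κ, hκ⟩ := hrel.dvd_of_dvd_mul_right ⟨_, hτy⟩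
  obtain ⟨μ, hμ⟩ := hmod α
  obtain ⟨ν, hν⟩ := hmod S
  refine Ideal.mem_span_pair.2 ⟨μ - κ * ν, κ * P + β, ?_⟩
  linear_combination h - P * hμ - P * hκ + κ * P * hν

/-- Elimination of a variable that occurs linearly in both of two generators. -/
theorem span_linear_pair_isRadical (i : Fin 6) {u v u' v' : MvPolynomial (Fin 6) ℝ} (hu : u ≠ 0)
    (hfree : ∀ q ∈ [u, v, u', v'],
      aeval (Function.update (X : Fin 6 → MvPolynomial (Fin 6) ℝ) i 0) q = q)
    (τ : MvPolynomial (Fin 6) ℝ →ₐ[ℝ] MvPolynomial (Fin 6) ℝ) (hτu : τ u = 0)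
    (hτ : ∀ j, u ∣ X j - τ (X j))
    (hsq : Squarefree (τ (u * X i + v) * τ (u' * X i + v')))
    (hρ : Squarefree (u * v' - u' * v)) :
    (Ideal.span {u * X i + v, u' * X i + v'}).IsRadical := by
  set g := u * X i + v
  set g' := u' * X i + v'
  set I := Ideal.span {g, g'}
  have hgI : g ∈ I := Ideal.subset_span (by simp)
  have hg'I : g' ∈ I := Ideal.subset_span (by simp)
  have hmod : ∀ y, u ∣ y - τ y := fun y => Ideal.mem_span_singleton.1
    (sub_mem_of_forall_X (fun j => Ideal.mem_span_singleton.2 (hτ j)) y)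
  -- `u` is a nonzerodivisor modulo `I`: modulo `u` the generators are coprime, so every relation
  -- between them is a multiple of the Koszul relation.
  have hreg : ∀ y, u * y ∈ I → y ∈ I := by
    intro y hy
    obtain ⟨α, β, h⟩ := Ideal.mem_span_pair.1 hy
    have hτy : τ α * τ g + τ β * τ g' = 0 := by
      rw [← map_mul, ← map_mul, ← map_add, h, map_mul, hτu, zero_mul]
    obtain ⟨γ, hγ⟩ := (IsRelPrime.of_squarefree_mul hsq).dvd_of_dvd_mul_right
      (⟨-τ α, by linear_combination hτy⟩ : τ g ∣ τ β * τ g')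
    have hα : τ α = -γ * τ g' := by
      have h0 : τ g ≠ 0 := left_ne_zero_of_mul hsq.ne_zero
      refine mul_left_cancel₀ h0 ?_
      rw [hγ] at hτy
      linear_combination hτy
    obtain ⟨a, ha⟩ := hmod α
    obtain ⟨b, hb⟩ := hmod β
    obtain ⟨c, hc⟩ := hmod g
    obtain ⟨d, hd⟩ := hmod g'
    have : y = (a + γ * d) * g + (b - γ * c) * g' := by
      refine mul_left_cancel₀ hu ?_
      linear_combination -h + g * ha + g * hα + g' * hb + g' * hγ + γ * g * hd - γ * g' * hc
    rw [this]
    exact I.add_mem (I.mul_mem_left _ hgI) (I.mul_mem_left _ hg'I)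
  have hregpow : ∀ (N : ℕ) y, u ^ N * y ∈ I → y ∈ I := by
    intro N
    induction N with
    | zero => intro y hy; simpa using hy
    | succ N ih => intro y hy; exact ih y (hreg _ (by rwa [← mul_assoc, ← pow_succ']))
  let K := FractionRing (MvPolynomial (Fin 6) ℝ)
  let ι : MvPolynomial (Fin 6) ℝ →ₐ[ℝ] K := Algebra.algHom ℝ _ K
  have hι : Function.Injective ι := IsFractionRing.injective (MvPolynomial (Fin 6) ℝ) K
  have hιu : ι u ≠ 0 := fun h => hu (hι (by rw [h, map_zero]))
  -- Once `u` is inverted, `g = 0` is solved by `X i = -v / u`, and `g'` turns into the resultant `u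
  -- * v' - u' * v` divided by `u`.
  let Θ : MvPolynomial (Fin 6) ℝ →ₐ[ℝ] K :=
    aeval (Function.update (fun j => ι (X j)) i (-ι v / ι u))
  have hΘfree : ∀ q ∈ [u, v, u', v'], Θ q = ι q := by
    intro q hq
    have h : Θ.comp (aeval (Function.update (X : Fin 6 → MvPolynomial (Fin 6) ℝ) i 0)) =
        ι.comp (aeval (Function.update (X : Fin 6 → MvPolynomial (Fin 6) ℝ) i 0)) := by
      refine algHom_ext fun j => ?_
      by_cases hj : j = i
      · subst hj; simp
      · simp [hj, Θ]
    have h' := congrArg (fun ψ => ψ q) h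
    simp only [AlgHom.comp_apply, hfree q hq] at h'
    exact h'
  have hΘX : ι u * Θ (X i) = -ι v := by
    simp only [Θ, aeval_X, Function.update_self]
    rw [mul_comm, div_mul_cancel₀ _ hιu]
  have hΘg : Θ g = 0 := by
    simp only [g, map_add, map_mul]
    rw [hΘfree u (by simp), hΘfree v (by simp), hΘX]
    ring
  have hΘg' : ι u * Θ g' = ι (u * v' - u' * v) := by
    simp only [g', map_add, map_mul, map_sub]
    rw [hΘfree u' (by simp), hΘfree v' (by simp)]
    linear_combination ι u' * hΘX
  -- The denominator of `Θ y` is cleared inside the polynomial ring, with a numerator `Y` congruent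
  -- to `u ^ N * y` modulo `I`.
  have hclear : ∀ y, ∃ (N : ℕ) (Y : MvPolynomial (Fin 6) ℝ),
      ι Y = ι u ^ N * Θ y ∧ u ^ N * y - Y ∈ I := by
    intro y
    induction y using MvPolynomial.induction_on with
    | C a =>
      refine ⟨0, C a, ?_, by simp⟩
      rw [pow_zero, one_mul, ← algebraMap_eq, AlgHom.commutes, AlgHom.commutes]
    | add p q hp hq =>
      obtain ⟨N, Y, h1, h2⟩ := hp
      obtain ⟨M, Z, h3, h4⟩ := hq
      refine ⟨N + M, u ^ M * Y + u ^ N * Z, ?_, ?_⟩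
      · simp only [map_add, map_mul, map_pow, h1, h3]
        ring
      · have := I.add_mem (I.mul_mem_left (u ^ M) h2) (I.mul_mem_left (u ^ N) h4)
        convert this using 1
        ring
    | mul_X p j hp =>
      obtain ⟨N, Y, h1, h2⟩ := hp
      by_cases hj : j = i
      · subst hj
        refine ⟨N + 1, -v * Y, ?_, ?_⟩
        · simp only [map_mul, map_neg, h1]
          linear_combination -ι u ^ N * Θ p * hΘX
        · have := I.sub_mem (I.mul_mem_left (u ^ N * p) hgI) (I.mul_mem_left v h2)
          convert this using 1
          simp only [g]
          ring
      · refine ⟨N, Y * X j, ?_, ?_⟩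
        · rw [map_mul, map_mul, h1]
          simp [Θ, hj, mul_assoc]
        · convert I.mul_mem_right (X j) h2 using 1
          ring
  rintro y ⟨n, hy⟩
  obtain ⟨α, β, h⟩ := Ideal.mem_span_pair.1 hy
  obtain ⟨N, Y, hY, hYI⟩ := hclear y
  obtain ⟨M, Z, hZ, -⟩ := hclear β
  have hdvd : Y ^ n * u ^ (M + 1) = (u * v' - u' * v) * (u ^ (N * n) * Z) := by
    apply hι
    have h' := congrArg Θ h
    simp only [map_add, map_mul, map_pow, hΘg, mul_zero, zero_add] at h'
    rw [map_mul, map_mul, map_mul, map_pow, map_pow, map_pow, hY, hZ, ← hΘg', mul_pow, ← h',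
      pow_mul, pow_succ]
    -- From `y ^ n ∈ I` the resultant divides a product of powers of `Y` and `u`; being squarefree,
    -- it divides `Y * u`. So `u ^ (N + 1) * y` lies in `I`, and `u` cancels.
    ring
  have hρY : u * v' - u' * v ∣ Y * u := by
    refine hρ.isRadical (n + (M + 1)) _ ((Dvd.intro _ hdvd.symm).trans ?_)
    rw [mul_pow, pow_add Y, pow_add u]
    exact ⟨Y ^ (M + 1) * u ^ n, by ring⟩
  have hρI : u * v' - u' * v ∈ I := by
    have := I.sub_mem (I.mul_mem_left u hg'I) (I.mul_mem_left u' hgI)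
    convert this using 1
    simp only [g, g']
    ring
  refine hregpow (N + 1) y ?_
  have := I.add_mem (I.mul_mem_left u hYI) (I.mem_of_dvd hρY hρI)
  convert this using 1
  ring

/-! ### Computable certificates of separability -/

/-- Univariate polynomials given by lists of coefficients. -/
noncomputable def ofCoeffs (c : List ℤ) : Polynomial ℝ :=
  c.foldr (fun a q => (a : Polynomial ℝ) + Polynomial.X * q) 0

def addCoeffs : List ℤ → List ℤ → List ℤ
  | [], b => b
  | a, [] => a
  | x :: a, y :: b => (x + y) :: addCoeffs a b

def mulCoeffs : List ℤ → List ℤ → List ℤ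
  | [], _ => []
  | x :: a, b => addCoeffs (b.map (x * ·)) (0 :: mulCoeffs a b)

/-- This is the product rule for `x + X * a`, whose derivative is `a + X * a'`. -/
def derivCoeffs : List ℤ → List ℤ
  | [] => []
  | _ :: a => addCoeffs a (0 :: derivCoeffs a)

theorem ofCoeffs_nil : ofCoeffs [] = 0 := rfl

theorem ofCoeffs_cons (x : ℤ) (a : List ℤ) :
    ofCoeffs (x :: a) = (x : Polynomial ℝ) + Polynomial.X * ofCoeffs a := rfl

theorem ofCoeffs_add (a b : List ℤ) :
    ofCoeffs (addCoeffs a b) = ofCoeffs a + ofCoeffs b := by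
  induction a generalizing b with
  | nil => simp [addCoeffs, ofCoeffs_nil]
  | cons x a ih =>
    cases b with
    | nil => simp [addCoeffs, ofCoeffs_nil]
    | cons y b =>
      simp only [addCoeffs, ofCoeffs_cons, ih, Int.cast_add]
      ring

theorem ofCoeffs_smul (x : ℤ) (b : List ℤ) :
    ofCoeffs (b.map (x * ·)) = (x : Polynomial ℝ) * ofCoeffs b := by
  induction b with
  | nil => simp [ofCoeffs_nil]
  | cons y b ih =>
    simp only [List.map_cons, ofCoeffs_cons, ih, Int.cast_mul]
    ring

theorem ofCoeffs_mul (a b : List ℤ) :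
    ofCoeffs (mulCoeffs a b) = ofCoeffs a * ofCoeffs b := by
  induction a with
  | nil => simp [mulCoeffs, ofCoeffs_nil]
  | cons x a ih =>
    simp only [mulCoeffs, ofCoeffs_add, ofCoeffs_smul, ofCoeffs_cons, ih, Int.cast_zero]
    ring

theorem ofCoeffs_deriv (a : List ℤ) :
    ofCoeffs (derivCoeffs a) = (ofCoeffs a).derivative := by
  induction a with
  | nil => simp [derivCoeffs, ofCoeffs_nil]
  | cons x a ih =>
    simp only [derivCoeffs, ofCoeffs_add, ofCoeffs_cons, ih, Int.cast_zero, Polynomial.derivative_add,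
      Polynomial.derivative_mul, Polynomial.derivative_X, Polynomial.derivative_intCast]
    ring

theorem coeff_ofCoeffs (a : List ℤ) (n : ℕ) : (ofCoeffs a).coeff n = (a.getD n 0 : ℤ) := by
  induction a generalizing n with
  | nil => simp [ofCoeffs_nil]
  | cons x a ih =>
    rw [ofCoeffs_cons, ← map_intCast (Polynomial.C : ℝ →+* _), Polynomial.coeff_add,
      Polynomial.coeff_C]
    cases n with
    | zero => simp
    | succ n => simp [ih]

/-- The coefficients of the restriction of `ofTerms l` to the line `a + t v`. -/
def restrictCoeffs (a v : Fin 6 → ℤ) (l : List (ℤ × List (Fin 6))) : List ℤ :=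
  l.foldr (fun t c => addCoeffs ((t.2.foldr (fun i q => mulCoeffs [a i, v i] q) [1]).map (t.1 * ·)) c)
    []

theorem ofCoeffs_restrictCoeffs (a v : Fin 6 → ℤ) (l : List (ℤ × List (Fin 6))) :
    aeval (fun i => (a i : Polynomial ℝ) + (v i : Polynomial ℝ) * Polynomial.X) (ofTerms l) =
      ofCoeffs (restrictCoeffs a v l) := by
  have h1 : ∀ s : List (Fin 6),
      aeval (fun i => (a i : Polynomial ℝ) + (v i : Polynomial ℝ) * Polynomial.X)
        (s.map (X : Fin 6 → MvPolynomial (Fin 6) ℝ)).prod =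
      ofCoeffs (s.foldr (fun i q => mulCoeffs [a i, v i] q) [1]) := fun s => by
    induction s with
    | nil => simp [ofCoeffs_cons, ofCoeffs_nil]
    | cons i s ih =>
      rw [List.map_cons, List.prod_cons, map_mul, ih, List.foldr_cons, ofCoeffs_mul, aeval_X]
      simp only [ofCoeffs_cons, ofCoeffs_nil]
      ring
  induction l with
  | nil => simp [ofTerms, restrictCoeffs, ofCoeffs_nil]
  | cons t l ih =>
    have h2 : ofTerms (t :: l) = (t.1 : MvPolynomial (Fin 6) ℝ) * (t.2.map X).prod + ofTerms l := by
      simp [ofTerms]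
    rw [h2, map_add, map_mul, ih, h1, map_intCast]
    simp only [restrictCoeffs, List.foldr_cons, ofCoeffs_add, ofCoeffs_smul]

/-- The coefficients `u` and `w` certify that the restriction of `ofTerms l` to the line `a + t v`
is separable of degree `n`. -/
def lineCheck (l : List (ℤ × List (Fin 6))) (n : ℕ) (a v : Fin 6 → ℤ) (u w : List ℤ) : Bool :=
  let h := restrictCoeffs a v l
  let r := addCoeffs (mulCoeffs u h) (mulCoeffs w (derivCoeffs h))
  l.all (fun t => t.2.length ≤ n) && h.getD n 0 != 0 && r.headD 0 != 0 && r.tail.all (· == 0)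

theorem squarefree_of_lineCheck {l : List (ℤ × List (Fin 6))} {n : ℕ} {a v : Fin 6 → ℤ}
    {u w : List ℤ} (h : lineCheck l n a v u w = true) : Squarefree (ofTerms l) := by
  simp only [lineCheck, Bool.and_eq_true, List.all_eq_true, decide_eq_true_eq, bne_iff_ne,
    beq_iff_eq] at h
  obtain ⟨⟨⟨h1, h2⟩, h3⟩, h4⟩ := h
  refine squarefree_of_line (totalDegree_ofTerms_le n l h1) a v (ofCoeffs_restrictCoeffs a v l)
    (Polynomial.le_natDegree_of_ne_zero ?_) (squarefree_of_bezout (ofCoeffs u) (ofCoeffs w) _ h3 ?_)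
  · rw [coeff_ofCoeffs]
    exact_mod_cast h2
  · rw [← ofCoeffs_deriv, ← ofCoeffs_mul, ← ofCoeffs_mul, ← ofCoeffs_add]
    have hz : ∀ c : List ℤ, (∀ x ∈ c, x = 0) → ofCoeffs c = 0 := fun c hc => by
      induction c with
      | nil => rfl
      | cons x c ih =>
        rw [ofCoeffs_cons, hc x List.mem_cons_self,
          ih fun y hy => hc y (List.mem_cons_of_mem _ hy)]
        simp
    have hr : ∀ c : List ℤ, (∀ x ∈ c.tail, x = 0) → ofCoeffs c = ((c.headD 0 : ℤ) : Polynomial ℝ) :=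
      fun c hc => by
      cases c with
      | nil => simp [ofCoeffs_nil]
      | cons x c =>
        rw [ofCoeffs_cons, hz c hc]
        simp
    exact hr _ h4

/-! ### Representatives leaving at most one polynomial after elimination -/

/-- If nothing remains after the elimination of variables, then the ideal is prime. -/
theorem maskIdeal_isRadical_of_linear {v : ℕ} (s : List ℕ) (p : Fin 6 → MvPolynomial (Fin 6) ℝ)
    (hx : ∀ (B : Type) [CommRing B] [Algebra ℝ B] (x : Fin 6 → B),
      (∀ n ∈ s, coupleMinor n x = 0) → ∀ i, x i = aeval x (p i))
    (hp : ∀ n ∈ s, coupleMinor n p = 0)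
    (hv : ∀ n : Fin 24, v.testBit n = s.contains n.1 := by decide +kernel)
    (hs : ∀ n ∈ s, n < 24 := by decide) : (maskIdeal v).IsRadical := by
  refine maskIdeal_isRadical_of_elimination s p ∅ hv hs ?_
    (fun B _ _ x h => ⟨hx B x h, by simp⟩) fun n hn => by rw [hp n hn]; exact Ideal.zero_mem _
  rw [Ideal.span_empty]
  exact Ideal.isPrime_bot.isRadical

/-- If one squarefree polynomial remains after the elimination of variables, then the ideal is
radical. -/
theorem maskIdeal_isRadical_of_squarefree {v : ℕ} (s : List ℕ)
    (p : Fin 6 → MvPolynomial (Fin 6) ℝ) (g : MvPolynomial (Fin 6) ℝ)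
    (hg : Squarefree g)
    (hx : ∀ (B : Type) [CommRing B] [Algebra ℝ B] (x : Fin 6 → B),
      (∀ n ∈ s, coupleMinor n x = 0) → (∀ i, x i = aeval x (p i)) ∧ aeval x g = 0)
    (hp : ∀ n ∈ s, g ∣ coupleMinor n p)
    (hv : ∀ n : Fin 24, v.testBit n = s.contains n.1 := by decide +kernel)
    (hs : ∀ n ∈ s, n < 24 := by decide) : (maskIdeal v).IsRadical :=
  maskIdeal_isRadical_of_elimination s p {g} hv hs (span_isRadical_of_squarefree hg)
    (fun B _ _ x h => ⟨(hx B x h).1, by simpa using (hx B x h).2⟩)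
    fun n hn => Ideal.mem_span_singleton.2 (hp n hn)

theorem isRadical_0 : (maskIdeal 0).IsRadical :=
  maskIdeal_isRadical_of_linear [] X (fun B _ _ x _ => by simp) (by simp)

theorem isRadical_1 : (maskIdeal 1).IsRadical :=
  maskIdeal_isRadical_of_linear [0] ![0, X 1, X 2, X 3, X 4, X 5]
    (fun B _ _ x h => by
      simp [coupleMinor] at h; simp [Fin.forall_fin_succ]; grind)
    (by simp [coupleMinor])

theorem isRadical_2 : (maskIdeal 2).IsRadical :=
  maskIdeal_isRadical_of_linear [1] ![X 1 * X 3, X 1, X 2, X 3, X 4, X 5]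
    (fun B _ _ x h => by
      simp [coupleMinor] at h; simp [Fin.forall_fin_succ]; grind)
    (by simp [coupleMinor])

/-- The pattern of the cases with one remaining polynomial `l`: `a + t v` is a line on which `l`
keeps its degree `n`, and `u`, `w` are the Bézout coefficients of the restriction and its
derivative. The witnesses at the end are the quotients of the substituted minors by that polynomial.
-/
theorem isRadical_8 : (maskIdeal 8).IsRadical := by
  refine maskIdeal_isRadical_of_squarefree [3] ![X 0, X 1, X 2, X 3, X 4, X 5] _
    (squarefree_of_lineCheck (l := [(1, [0]), (-1, [1, 3]), (-1, [2, 4]), (-1, [0, 5, 5]), (1, [1,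
      4, 5]), (1, [2, 3, 5])]) (n := 3)
      (a := ![2, 1, 1, 2, -1, 0]) (v := ![1, -1, 2, 1, -1, 1]) (u := [-3]) (w := [1, 1])
        (by decide +kernel))
    (fun B _ _ x h => ?_) ?_
  · simp [coupleMinor] at h
    simp [Fin.forall_fin_succ, ofTerms]
    grind
  · simp only [List.forall_mem_cons]
    refine ⟨⟨1, ?_⟩, by simp⟩ <;>
      simp [coupleMinor, ofTerms] <;> ring

theorem isRadical_6 : (maskIdeal 6).IsRadical := by
  refine maskIdeal_isRadical_of_squarefree [1, 2] ![X 1 * X 3, X 1, X 2, X 3, X 4, X 5] _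
    (squarefree_of_lineCheck (l := [(1, [1, 3]), (-1, [2, 4])]) (n := 2)
      (a := ![0, 2, 1, 0, 1, 0]) (v := ![0, 1, 1, 1, 2, 0]) (u := [-4]) (w := [1, 2])
        (by decide +kernel))
    (fun B _ _ x h => ?_) ?_
  · simp [coupleMinor] at h
    simp [Fin.forall_fin_succ, ofTerms]
    grind
  · simp only [List.forall_mem_cons]
    refine ⟨⟨0, ?_⟩, ⟨1, ?_⟩, by simp⟩ <;>
      simp [coupleMinor, ofTerms] <;> ring

theorem isRadical_9 : (maskIdeal 9).IsRadical := by
  refine maskIdeal_isRadical_of_squarefree [0, 3] ![0, X 1, X 2, X 3, X 4, X 5] _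
    (squarefree_of_lineCheck (l := [(-1, [1, 3]), (-1, [2, 4]), (1, [1, 4, 5]), (1, [2, 3, 5])])
      (n := 3)
      (a := ![0, 0, -1, 0, 1, 0]) (v := ![0, 1, 1, 0, 1, 1]) (u := [3]) (w := [0, -1])
        (by decide +kernel))
    (fun B _ _ x h => ?_) ?_
  · simp [coupleMinor] at h
    simp [Fin.forall_fin_succ, ofTerms]
    grind
  · simp only [List.forall_mem_cons]
    refine ⟨⟨0, ?_⟩, ⟨1, ?_⟩, by simp⟩ <;>
      simp [coupleMinor, ofTerms] <;> ring

theorem isRadical_20 : (maskIdeal 20).IsRadical :=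
  maskIdeal_isRadical_of_linear [2, 4] ![X 2 * X 4, 0, X 2, X 3, X 4, X 5]
    (fun B _ _ x h => by
      simp [coupleMinor] at h; simp [Fin.forall_fin_succ]; grind)
    (by simp [coupleMinor])

theorem isRadical_24 : (maskIdeal 24).IsRadical := by
  refine maskIdeal_isRadical_of_squarefree [3, 4] ![X 0, 0, X 2, X 3, X 4, X 5] _
    (squarefree_of_lineCheck (l := [(1, [0]), (-1, [2, 4]), (-1, [0, 5, 5]), (1, [2, 3, 5])])
      (n := 3)
      (a := ![-2, 0, 1, -1, 1, -2]) (v := ![-1, 0, 1, 0, 1, -1]) (u := [-3]) (w := [2, 1])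
        (by decide +kernel))
    (fun B _ _ x h => ?_) ?_
  · simp [coupleMinor] at h
    simp [Fin.forall_fin_succ, ofTerms]
    grind
  · simp only [List.forall_mem_cons]
    refine ⟨⟨1, ?_⟩, ⟨0, ?_⟩, by simp⟩ <;>
      simp [coupleMinor, ofTerms] <;> ring

theorem isRadical_36 : (maskIdeal 36).IsRadical :=
  maskIdeal_isRadical_of_linear [2, 5] ![X 2 * X 4, X 2 * X 3 * X 4, X 2, X 3, X 4, X 5]
    (fun B _ _ x h => by
      simp [coupleMinor] at h; simp [Fin.forall_fin_succ]; grind)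
    (by simp [coupleMinor] <;> grind)

theorem isRadical_40 : (maskIdeal 40).IsRadical := by
  refine maskIdeal_isRadical_of_squarefree [3, 5] ![X 0, X 0 * X 3, X 2, X 3, X 4, X 5] _
    (squarefree_of_lineCheck (l := [(1, [0]), (-1, [2, 4]), (-1, [0, 3, 3]), (-1, [0, 5, 5]), (1,
      [2, 3, 5]), (1, [0, 3, 4, 5])]) (n := 4)
      (a := ![1, 0, -1, 0, 1, 1]) (v := ![1, 0, 1, -1, -1, -1]) (u := [4]) (w := [0, -1])
        (by decide +kernel))
    (fun B _ _ x h => ?_) ?_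
  · simp [coupleMinor] at h
    simp [Fin.forall_fin_succ, ofTerms]
    grind
  · simp only [List.forall_mem_cons]
    refine ⟨⟨1, ?_⟩, ⟨0, ?_⟩, by simp⟩ <;>
      simp [coupleMinor, ofTerms] <;> ring

theorem isRadical_4352 : (maskIdeal 4352).IsRadical :=
  maskIdeal_isRadical_of_linear [8, 12] ![X 0, X 1, 0, 0, X 4, X 5]
    (fun B _ _ x h => by
      simp [coupleMinor] at h; simp [Fin.forall_fin_succ]; grind)
    (by simp [coupleMinor])

theorem isRadical_4608 : (maskIdeal 4608).IsRadical :=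
  maskIdeal_isRadical_of_linear [9, 12] ![X 0, X 1, X 0 * X 4, 0, X 4, X 5]
    (fun B _ _ x h => by
      simp [coupleMinor] at h; simp [Fin.forall_fin_succ]; grind)
    (by simp [coupleMinor])

theorem isRadical_6144 : (maskIdeal 6144).IsRadical :=
  maskIdeal_isRadical_of_linear [11, 12] ![X 0, X 1, X 0 * X 4 + X 1 * X 5, 0, X 4, X 5]
    (fun B _ _ x h => by
      simp [coupleMinor] at h; simp [Fin.forall_fin_succ]; grind)
    (by simp [coupleMinor])

theorem isRadical_8704 : (maskIdeal 8704).IsRadical :=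
  maskIdeal_isRadical_of_linear [9, 13] ![X 0, X 1, X 0 * X 4, X 0 * X 1, X 4, X 5]
    (fun B _ _ x h => by
      simp [coupleMinor] at h; simp [Fin.forall_fin_succ]; grind)
    (by simp [coupleMinor])

theorem isRadical_10240 : (maskIdeal 10240).IsRadical := by
  refine maskIdeal_isRadical_of_squarefree [11, 13] ![X 0, X 1, X 2, X 0 * X 1, X 4, X 5] _
    (squarefree_of_lineCheck (l := [(1, [2]), (-1, [0, 4]), (-1, [1, 5]), (1, [0, 0, 1, 5]), (1,
      [0, 1, 1, 4]), (-1, [0, 0, 1, 1, 2])]) (n := 5)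
      (a := ![2, 2, 0, 0, 0, 0]) (v := ![1, -1, -1, 0, 1, 1]) (u := [0, 26, 0, -5]) (w := [12, 0,
        -10, 0, 1]) (by decide +kernel))
    (fun B _ _ x h => ?_) ?_
  · simp [coupleMinor] at h
    simp [Fin.forall_fin_succ, ofTerms]
    grind
  · simp only [List.forall_mem_cons]
    refine ⟨⟨1, ?_⟩, ⟨0, ?_⟩, by simp⟩ <;>
      simp [coupleMinor, ofTerms] <;> ring

theorem isRadical_296 : (maskIdeal 296).IsRadical := by
  refine maskIdeal_isRadical_of_squarefree [3, 5, 8] ![X 0, X 0 * X 3, 0, X 3, X 4, X 5] _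
    (squarefree_of_lineCheck (l := [(1, [0]), (-1, [0, 3, 3]), (-1, [0, 5, 5]), (1, [0, 3, 4,
      5])]) (n := 4)
      (a := ![-1, 0, 0, 1, 2, 1]) (v := ![1, 0, 0, 1, 1, 2]) (u := [-18, 0, 8]) (w := [0, 5, 0,
        -2]) (by decide +kernel))
    (fun B _ _ x h => ?_) ?_
  · simp [coupleMinor] at h
    simp [Fin.forall_fin_succ, ofTerms]
    grind
  · simp only [List.forall_mem_cons]
    refine ⟨⟨1, ?_⟩, ⟨0, ?_⟩, ⟨0, ?_⟩, by simp⟩ <;>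
      simp [coupleMinor, ofTerms] <;> ring

theorem isRadical_578 : (maskIdeal 578).IsRadical := by
  refine maskIdeal_isRadical_of_squarefree [1, 6, 9] ![X 2 * X 3 * X 5, X 2 * X 5, X 2, X 3, X 4,
    X 5] _
    (squarefree_of_lineCheck (l := [(1, [2]), (-1, [2, 3, 4, 5])]) (n := 4)
      (a := ![0, 0, 2, -2, 1, -1]) (v := ![0, 0, -1, 2, -1, 1]) (u := [2, 8]) (w := [1, 2, -2])
        (by decide +kernel))
    (fun B _ _ x h => ?_) ?_
  · simp [coupleMinor] at h
    simp [Fin.forall_fin_succ, ofTerms]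
    grind
  · simp only [List.forall_mem_cons]
    refine ⟨⟨0, ?_⟩, ⟨0, ?_⟩, ⟨1, ?_⟩, by simp⟩ <;>
      simp [coupleMinor, ofTerms] <;> ring

theorem isRadical_4360 : (maskIdeal 4360).IsRadical := by
  refine maskIdeal_isRadical_of_squarefree [3, 8, 12] ![X 0, X 1, 0, 0, X 4, X 5] _
    (squarefree_of_lineCheck (l := [(1, [0]), (-1, [0, 5, 5]), (1, [1, 4, 5])]) (n := 3)
      (a := ![1, -1, 0, 0, -1, 0]) (v := ![-1, -1, 0, 0, 0, 1]) (u := [3]) (w := [0, -1])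
        (by decide +kernel))
    (fun B _ _ x h => ?_) ?_
  · simp [coupleMinor] at h
    simp [Fin.forall_fin_succ, ofTerms]
    grind
  · simp only [List.forall_mem_cons]
    refine ⟨⟨1, ?_⟩, ⟨0, ?_⟩, ⟨0, ?_⟩, by simp⟩ <;>
      simp [coupleMinor, ofTerms] <;> ring

theorem isRadical_4616 : (maskIdeal 4616).IsRadical := by
  refine maskIdeal_isRadical_of_squarefree [3, 9, 12] ![X 0, X 1, X 0 * X 4, 0, X 4, X 5] _
    (squarefree_of_lineCheck (l := [(1, [0]), (-1, [0, 4, 4]), (-1, [0, 5, 5]), (1, [1, 4, 5])])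
      (n := 3)
      (a := ![1, 0, 0, 0, 0, -2]) (v := ![1, 1, 0, 0, 1, 0]) (u := [-3]) (w := [1, 1])
        (by decide +kernel))
    (fun B _ _ x h => ?_) ?_
  · simp [coupleMinor] at h
    simp [Fin.forall_fin_succ, ofTerms]
    grind
  · simp only [List.forall_mem_cons]
    refine ⟨⟨1, ?_⟩, ⟨0, ?_⟩, ⟨0, ?_⟩, by simp⟩ <;>
      simp [coupleMinor, ofTerms] <;> ring

theorem isRadical_4672 : (maskIdeal 4672).IsRadical :=
  maskIdeal_isRadical_of_linear [6, 9, 12] ![X 0, X 0 * X 4 * X 5, X 0 * X 4, 0, X 4, X 5]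
    (fun B _ _ x h => by
      simp [coupleMinor] at h; simp [Fin.forall_fin_succ]; grind)
    (by simp [coupleMinor])

theorem isRadical_5632 : (maskIdeal 5632).IsRadical := by
  refine maskIdeal_isRadical_of_squarefree [9, 10, 12] ![X 0, X 1, X 0 * X 4, 0, X 4, X 5] _
    (squarefree_of_lineCheck (l := [(1, [0, 4]), (-1, [1, 5])]) (n := 2)
      (a := ![2, 1, 0, 0, 0, 1]) (v := ![1, 1, 0, 0, 1, 2]) (u := [-4]) (w := [1, 2])
        (by decide +kernel))
    (fun B _ _ x h => ?_) ?_
  · simp [coupleMinor] at h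
    simp [Fin.forall_fin_succ, ofTerms]
    grind
  · simp only [List.forall_mem_cons]
    refine ⟨⟨0, ?_⟩, ⟨1, ?_⟩, ⟨0, ?_⟩, by simp⟩ <;>
      simp [coupleMinor, ofTerms] <;> ring

theorem isRadical_6148 : (maskIdeal 6148).IsRadical := by
  refine maskIdeal_isRadical_of_squarefree [2, 11, 12] ![X 2 * X 4, X 1, X 2, 0, X 4, X 5] _
    (squarefree_of_lineCheck (l := [(1, [2]), (-1, [1, 5]), (-1, [2, 4, 4])]) (n := 3)
      (a := ![0, -1, 1, 0, 1, -1]) (v := ![0, 1, -1, 0, 1, 1]) (u := [-3]) (w := [0, 1])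
        (by decide +kernel))
    (fun B _ _ x h => ?_) ?_
  · simp [coupleMinor] at h
    simp [Fin.forall_fin_succ, ofTerms]
    grind
  · simp only [List.forall_mem_cons]
    refine ⟨⟨0, ?_⟩, ⟨1, ?_⟩, ⟨0, ?_⟩, by simp⟩ <;>
      simp [coupleMinor, ofTerms] <;> ring

theorem isRadical_6400 : (maskIdeal 6400).IsRadical := by
  refine maskIdeal_isRadical_of_squarefree [8, 11, 12] ![X 0, X 1, 0, 0, X 4, X 5] _
    (squarefree_of_lineCheck (l := [(-1, [0, 4]), (-1, [1, 5])]) (n := 2)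
      (a := ![-2, 1, 0, 0, 2, -2]) (v := ![1, -1, 0, 0, 0, 2]) (u := [4]) (w := [3, -2])
        (by decide +kernel))
    (fun B _ _ x h => ?_) ?_
  · simp [coupleMinor] at h
    simp [Fin.forall_fin_succ, ofTerms]
    grind
  · simp only [List.forall_mem_cons]
    refine ⟨⟨0, ?_⟩, ⟨1, ?_⟩, ⟨0, ?_⟩, by simp⟩ <;>
      simp [coupleMinor, ofTerms] <;> ring

theorem isRadical_8712 : (maskIdeal 8712).IsRadical := by
  refine maskIdeal_isRadical_of_squarefree [3, 9, 13] ![X 0, X 1, X 0 * X 4, X 0 * X 1, X 4, X 5]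
    _
    (squarefree_of_lineCheck (l := [(1, [0]), (-1, [0, 1, 1]), (-1, [0, 4, 4]), (-1, [0, 5, 5]),
      (1, [1, 4, 5]), (1, [0, 0, 1, 4, 5])]) (n := 5)
      (a := ![0, 2, 0, 0, 2, 0]) (v := ![1, 1, 0, 0, -1, 1]) (u := [0, 0, 0, 25]) (w := [-12, 0,
        0, 0, -5]) (by decide +kernel))
    (fun B _ _ x h => ?_) ?_
  · simp [coupleMinor] at h
    simp [Fin.forall_fin_succ, ofTerms]
    grind
  · simp only [List.forall_mem_cons]
    refine ⟨⟨1, ?_⟩, ⟨0, ?_⟩, ⟨0, ?_⟩, by simp⟩ <;>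
      simp [coupleMinor, ofTerms] <;> ring

theorem isRadical_8768 : (maskIdeal 8768).IsRadical :=
  maskIdeal_isRadical_of_linear [6, 9, 13] ![X 0, X 0 * X 4 * X 5, X 0 * X 4, X 0 ^ 2 * X 4 * X 5,
    X 4, X 5]
    (fun B _ _ x h => by
      simp [coupleMinor] at h; simp [Fin.forall_fin_succ]; grind)
    (by simp [coupleMinor] <;> grind)

theorem isRadical_9728 : (maskIdeal 9728).IsRadical := by
  refine maskIdeal_isRadical_of_squarefree [9, 10, 13] ![X 0, X 1, X 0 * X 4, X 0 * X 1, X 4, X 5]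
    _
    (squarefree_of_lineCheck (l := [(1, [0, 4]), (-1, [1, 5])]) (n := 2)
      (a := ![2, 1, 0, 0, 0, 1]) (v := ![1, 1, 0, 0, 1, 2]) (u := [-4]) (w := [1, 2])
        (by decide +kernel))
    (fun B _ _ x h => ?_) ?_
  · simp [coupleMinor] at h
    simp [Fin.forall_fin_succ, ofTerms]
    grind
  · simp only [List.forall_mem_cons]
    refine ⟨⟨0, ?_⟩, ⟨1, ?_⟩, ⟨0, ?_⟩, by simp⟩ <;>
      simp [coupleMinor, ofTerms] <;> ring

theorem isRadical_10244 : (maskIdeal 10244).IsRadical := by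
  refine maskIdeal_isRadical_of_squarefree [2, 11, 13] ![X 2 * X 4, X 1, X 2, X 1 * X 2 * X 4, X
    4, X 5] _
    (squarefree_of_lineCheck (l := [(1, [2]), (-1, [1, 5]), (-1, [2, 4, 4]), (1, [1, 1, 2, 4, 4]),
      (1, [1, 2, 2, 4, 4, 5]), (-1, [1, 1, 2, 2, 2, 4, 4])]) (n := 7)
      (a := ![0, 0, 0, 0, 0, 1]) (v := ![0, 2, -1, 0, 1, 0]) (u := [0, -849, 0, 2430, 0, -6412])
        (w := [-594, 0, 255, 0, -478, 0, 916]) (by decide +kernel))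
    (fun B _ _ x h => ?_) ?_
  · simp [coupleMinor] at h
    simp [Fin.forall_fin_succ, ofTerms]
    grind
  · simp only [List.forall_mem_cons]
    refine ⟨⟨0, ?_⟩, ⟨1, ?_⟩, ⟨0, ?_⟩, by simp⟩ <;>
      simp [coupleMinor, ofTerms] <;> ring

theorem isRadical_10496 : (maskIdeal 10496).IsRadical := by
  refine maskIdeal_isRadical_of_squarefree [8, 11, 13] ![X 0, X 1, 0, X 0 * X 1, X 4, X 5] _
    (squarefree_of_lineCheck (l := [(-1, [0, 4]), (-1, [1, 5]), (1, [0, 0, 1, 5]), (1, [0, 1, 1,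
      4])]) (n := 4)
      (a := ![0, -1, 0, 0, 0, 1]) (v := ![1, 1, 0, 0, -1, 2]) (u := [17, 12]) (w := [4, -5, -3])
        (by decide +kernel))
    (fun B _ _ x h => ?_) ?_
  · simp [coupleMinor] at h
    simp [Fin.forall_fin_succ, ofTerms]
    grind
  · simp only [List.forall_mem_cons]
    refine ⟨⟨0, ?_⟩, ⟨1, ?_⟩, ⟨0, ?_⟩, by simp⟩ <;>
      simp [coupleMinor, ofTerms] <;> ring

theorem isRadical_16912 : (maskIdeal 16912).IsRadical :=
  maskIdeal_isRadical_of_linear [4, 9, 14] ![X 0, 0, X 0 * X 4, X 4 * X 5, X 4, X 5]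
    (fun B _ _ x h => by
      simp [coupleMinor] at h; simp [Fin.forall_fin_succ]; grind)
    (by simp [coupleMinor])

theorem isRadical_18433 : (maskIdeal 18433).IsRadical := by
  refine maskIdeal_isRadical_of_squarefree [0, 11, 14] ![0, X 1, X 2, X 4 * X 5, X 4, X 5] _
    (squarefree_of_lineCheck (l := [(1, [2]), (-1, [1, 5]), (1, [1, 4, 4, 5]), (-1, [2, 4, 4, 5,
      5])]) (n := 5)
      (a := ![0, 0, 0, 0, 0, 0]) (v := ![0, 0, 2, 0, 1, 1]) (u := [0, 0, 0, 25]) (w := [4, 0, 0,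
        0, -5]) (by decide +kernel))
    (fun B _ _ x h => ?_) ?_
  · simp [coupleMinor] at h
    simp [Fin.forall_fin_succ, ofTerms]
    grind
  · simp only [List.forall_mem_cons]
    refine ⟨⟨0, ?_⟩, ⟨1, ?_⟩, ⟨0, ?_⟩, by simp⟩ <;>
      simp [coupleMinor, ofTerms] <;> ring

theorem isRadical_35072 : (maskIdeal 35072).IsRadical := by
  refine maskIdeal_isRadical_of_squarefree [8, 11, 15] ![X 0, X 1, 0, X 0 * X 1 + X 4 * X 5, X 4,
    X 5] _
    (squarefree_of_lineCheck (l := [(-1, [0, 4]), (-1, [1, 5]), (1, [0, 0, 1, 5]), (1, [0, 1, 1,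
      4]), (1, [0, 4, 5, 5]), (1, [1, 4, 4, 5])]) (n := 4)
      (a := ![-1, 0, 0, 0, 1, 0]) (v := ![1, -1, 0, 0, 1, -1]) (u := [6, 0, 8]) (w := [0, -1, 0,
        -2]) (by decide +kernel))
    (fun B _ _ x h => ?_) ?_
  · simp [coupleMinor] at h
    simp [Fin.forall_fin_succ, ofTerms]
    grind
  · simp only [List.forall_mem_cons]
    refine ⟨⟨0, ?_⟩, ⟨1, ?_⟩, ⟨0, ?_⟩, by simp⟩ <;>
      simp [coupleMinor, ofTerms] <;> ring

theorem isRadical_51 : (maskIdeal 51).IsRadical :=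
  maskIdeal_isRadical_of_linear [0, 1, 4, 5] ![0, 0, X 2, X 3, X 4, X 5]
    (fun B _ _ x h => by
      simp [coupleMinor] at h; simp [Fin.forall_fin_succ]; grind)
    (by simp [coupleMinor])

theorem isRadical_204 : (maskIdeal 204).IsRadical :=
  maskIdeal_isRadical_of_linear [2, 3, 6, 7] ![X 2 * X 4, X 2 * X 5, X 2, X 3, X 4, X 5]
    (fun B _ _ x h => by
      simp [coupleMinor] at h; simp [Fin.forall_fin_succ]; grind)
    (by simp [coupleMinor] <;> grind)

theorem isRadical_74880 : (maskIdeal 74880).IsRadical := by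
  refine maskIdeal_isRadical_of_squarefree [7, 10, 13, 16] ![X 0, X 1, X 1 * X 5, X 0 * X 1, 0, X
    5] _
    (squarefree_of_lineCheck (l := [(1, [1]), (-1, [0, 0, 1]), (-1, [1, 5, 5])]) (n := 3)
      (a := ![-1, 2, 0, 0, 0, -2]) (v := ![1, 1, 0, 0, 0, 0]) (u := [-3]) (w := [0, 1])
        (by decide +kernel))
    (fun B _ _ x h => ?_) ?_
  · simp [coupleMinor] at h
    simp [Fin.forall_fin_succ, ofTerms]
    grind
  · simp only [List.forall_mem_cons]
    refine ⟨⟨1, ?_⟩, ⟨0, ?_⟩, ⟨0, ?_⟩, ⟨0, ?_⟩, by simp⟩ <;>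
      simp [coupleMinor, ofTerms] <;> ring

theorem isRadical_75840 : (maskIdeal 75840).IsRadical := by
  refine maskIdeal_isRadical_of_squarefree [6, 11, 13, 16] ![X 0, X 2 * X 5, X 2, X 0 * X 2 * X 5,
    0, X 5] _
    (squarefree_of_lineCheck (l := [(1, [2]), (-1, [2, 5, 5]), (1, [0, 0, 2, 5, 5]), (-1, [0, 0,
      2, 2, 2, 5, 5])]) (n := 7)
      (a := ![0, 0, 0, 0, 0, 0]) (v := ![1, 0, 1, 0, 0, 1]) (u := [0, 34, 0, -45, 0, 63]) (w :=
        [8, 0, -10, 0, 9, 0, -9]) (by decide +kernel))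
    (fun B _ _ x h => ?_) ?_
  · simp [coupleMinor] at h
    simp [Fin.forall_fin_succ, ofTerms]
    grind
  · simp only [List.forall_mem_cons]
    refine ⟨⟨0, ?_⟩, ⟨1, ?_⟩, ⟨0, ?_⟩, ⟨0, ?_⟩, by simp⟩ <;>
      simp [coupleMinor, ofTerms] <;> ring

theorem isRadical_148512 : (maskIdeal 148512).IsRadical := by
  refine maskIdeal_isRadical_of_squarefree [5, 10, 14, 17] ![X 0, X 0 ^ 2 * X 2 * X 5, X 2, X 0 *
    X 2 * X 5, X 0 * X 2, X 5] _
    (squarefree_of_lineCheck (l := [(1, [2]), (-1, [0, 0, 2, 5, 5])]) (n := 5)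
      (a := ![0, 0, 0, 0, 0, 0]) (v := ![1, 0, 2, 0, 0, 2]) (u := [0, 0, 0, 25]) (w := [1, 0, 0,
        0, -5]) (by decide +kernel))
    (fun B _ _ x h => ?_) ?_
  · simp [coupleMinor] at h
    simp [Fin.forall_fin_succ, ofTerms]
    grind
  · simp only [List.forall_mem_cons]
    refine ⟨⟨0, ?_⟩, ⟨1, ?_⟩, ⟨0, ?_⟩, ⟨0, ?_⟩, by simp⟩ <;>
      simp [coupleMinor, ofTerms] <;> ring

theorem isRadical_4300 : (maskIdeal 4300).IsRadical :=
  maskIdeal_isRadical_of_linear [2, 3, 6, 7, 12] ![X 2 * X 4, X 2 * X 5, X 2, 0, X 4, X 5]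
    (fun B _ _ x h => by
      simp [coupleMinor] at h; simp [Fin.forall_fin_succ]; grind)
    (by simp [coupleMinor] <;> grind)

theorem isRadical_8396 : (maskIdeal 8396).IsRadical :=
  maskIdeal_isRadical_of_linear [2, 3, 6, 7, 13] ![X 2 * X 4, X 2 * X 5, X 2, X 2 ^ 2 * X 4 * X 5,
    X 4, X 5]
    (fun B _ _ x h => by
      simp [coupleMinor] at h; simp [Fin.forall_fin_succ]; grind)
    (by simp [coupleMinor] <;> grind)

theorem isRadical_12340 : (maskIdeal 12340).IsRadical :=
  maskIdeal_isRadical_of_linear [2, 4, 5, 12, 13] ![X 2 * X 4, 0, X 2, 0, X 4, X 5]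
    (fun B _ _ x h => by
      simp [coupleMinor] at h; simp [Fin.forall_fin_succ]; grind)
    (by simp [coupleMinor])

theorem isRadical_12344 : (maskIdeal 12344).IsRadical := by
  refine maskIdeal_isRadical_of_squarefree [3, 4, 5, 12, 13] ![X 0, 0, X 2, 0, X 4, X 5] _
    (squarefree_of_lineCheck (l := [(1, [0]), (-1, [2, 4]), (-1, [0, 5, 5])]) (n := 3)
      (a := ![0, 0, -1, 0, 1, 1]) (v := ![-1, 0, 2, 0, 2, 2]) (u := [3]) (w := [0, -1])
        (by decide +kernel))
    (fun B _ _ x h => ?_) ?_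
  · simp [coupleMinor] at h
    simp [Fin.forall_fin_succ, ofTerms]
    grind
  · simp only [List.forall_mem_cons]
    refine ⟨⟨1, ?_⟩, ⟨0, ?_⟩, ⟨0, ?_⟩, ⟨0, ?_⟩, ⟨0, ?_⟩, by simp⟩ <;>
      simp [coupleMinor, ofTerms] <;> ring

theorem isRadical_12339 : (maskIdeal 12339).IsRadical :=
  maskIdeal_isRadical_of_linear [0, 1, 4, 5, 12, 13] ![0, 0, X 2, 0, X 4, X 5]
    (fun B _ _ x h => by
      simp [coupleMinor] at h; simp [Fin.forall_fin_succ]; grind)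
    (by simp [coupleMinor])

theorem isRadical_49356 : (maskIdeal 49356).IsRadical :=
  maskIdeal_isRadical_of_linear [2, 3, 6, 7, 14, 15] ![X 2 * X 4, X 2 * X 5, X 2, X 4 * X 5, X 4,
    X 5]
    (fun B _ _ x h => by
      simp [coupleMinor] at h; simp [Fin.forall_fin_succ]; grind)
    (by simp [coupleMinor] <;> grind)

theorem isRadical_13063 : (maskIdeal 13063).IsRadical :=
  maskIdeal_isRadical_of_linear [0, 1, 2, 8, 9, 12, 13] ![0, X 1, 0, 0, X 4, X 5]
    (fun B _ _ x h => by
      simp [coupleMinor] at h; simp [Fin.forall_fin_succ]; grind)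
    (by simp [coupleMinor])

theorem isRadical_15024 : (maskIdeal 15024).IsRadical :=
  maskIdeal_isRadical_of_linear [4, 5, 7, 9, 11, 12, 13] ![X 0, 0, X 0 * X 4, 0, X 4, X 5]
    (fun B _ _ x h => by
      simp [coupleMinor] at h; simp [Fin.forall_fin_succ]; grind)
    (by simp [coupleMinor])

theorem isRadical_51936 : (maskIdeal 51936).IsRadical :=
  maskIdeal_isRadical_of_linear [5, 6, 7, 9, 11, 14, 15] ![X 0, X 0 * X 4 * X 5, X 0 * X 4, X 4 *
    X 5, X 4, X 5]
    (fun B _ _ x h => by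
      simp [coupleMinor] at h; simp [Fin.forall_fin_succ]; grind)
    (by simp [coupleMinor] <;> grind)

theorem isRadical_4095 : (maskIdeal 4095).IsRadical :=
  maskIdeal_isRadical_of_linear [0, 1, 2, 3, 4, 5, 6, 7, 8, 9, 10, 11] ![0, 0, 0, X 3, X 4, X 5]
    (fun B _ _ x h => by
      simp [coupleMinor] at h; simp [Fin.forall_fin_succ]; grind)
    (by simp [coupleMinor])

theorem isRadical_16383 : (maskIdeal 16383).IsRadical :=
  maskIdeal_isRadical_of_linear [0, 1, 2, 3, 4, 5, 6, 7, 8, 9, 10, 11, 12, 13] ![0, 0, 0, 0, X 4,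
    X 5]
    (fun B _ _ x h => by
      simp [coupleMinor] at h; simp [Fin.forall_fin_succ]; grind)
    (by simp [coupleMinor])

theorem isRadical_53247 : (maskIdeal 53247).IsRadical :=
  maskIdeal_isRadical_of_linear [0, 1, 2, 3, 4, 5, 6, 7, 8, 9, 10, 11, 14, 15] ![0, 0, 0, X 4 * X
    5, X 4, X 5]
    (fun B _ _ x h => by
      simp [coupleMinor] at h; simp [Fin.forall_fin_succ]; grind)
    (by simp [coupleMinor])

theorem isRadical_1048560 : (maskIdeal 1048560).IsRadical :=
  maskIdeal_isRadical_of_linear [4, 5, 6, 7, 8, 9, 10, 11, 12, 13, 14, 15, 16, 17, 18, 19] ![X 0,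
    0, 0, 0, 0, X 5]
    (fun B _ _ x h => by
      simp [coupleMinor] at h; simp [Fin.forall_fin_succ]; grind)
    (by simp [coupleMinor])

theorem isRadical_1048575 : (maskIdeal 1048575).IsRadical :=
  maskIdeal_isRadical_of_linear [0, 1, 2, 3, 4, 5, 6, 7, 8, 9, 10, 11, 12, 13, 14, 15, 16, 17, 18,
    19] ![0, 0, 0, 0, 0, X 5]
    (fun B _ _ x h => by
      simp [coupleMinor] at h; simp [Fin.forall_fin_succ]; grind)
    (by simp [coupleMinor])

theorem isRadical_16777215 : (maskIdeal 16777215).IsRadical :=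
  maskIdeal_isRadical_of_linear [0, 1, 2, 3, 4, 5, 6, 7, 8, 9, 10, 11, 12, 13, 14, 15, 16, 17, 18,
    19, 20, 21, 22, 23] ![0, 0, 0, 0, 0, 0]
    (fun B _ _ x h => by
      simp [coupleMinor] at h; simp [Fin.forall_fin_succ]; grind)
    (by simp [coupleMinor])

/-! ### Representatives leaving two polynomials -/

theorem squarefree_of_eq_ofTerms {g : MvPolynomial (Fin 6) ℝ} {l : List (ℤ × List (Fin 6))}
    {n : ℕ} {a v : Fin 6 → ℤ} {u w : List ℤ} (hg : g = ofTerms l)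
    (h : lineCheck l n a v u w = true) : Squarefree g :=
  hg ▸ squarefree_of_lineCheck h

/-- Both minors are linear in r₁₂. The two certificates concern the product of the generators on the
hypersurface `u = 0` and the resultant; the next two cases eliminate r₃₄ in the same way. -/
theorem isRadical_34816 : (maskIdeal 34816).IsRadical := by
  have hu : (X 3 * X 5 - X 4 : MvPolynomial (Fin 6) ℝ) ≠ 0 := by
    intro h
    have := congrArg (aeval (fun _ => 2 : Fin 6 → ℝ)) h
    norm_num [aeval_X] at this
  have hG := span_linear_pair_isRadical 0 (u := X 3 * X 5 - X 4)
    (v := X 2 - X 2 * X 3 ^ 2 - X 1 * X 5 + X 1 * X 3 * X 4)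
    (u' := X 2 * X 5 - X 1)
    (v' := X 3 - X 4 * X 5 + X 1 * X 2 * X 4 - X 2 ^ 2 * X 3) hu
    (by simp) (aeval ![X 0, X 1, X 2, X 3, X 3 * X 5, X 5]) (by simp)
    (by simp [Fin.forall_fin_succ]; exact ⟨-1, by ring⟩)
    (
  squarefree_of_eq_ofTerms (l := [(1, [2, 3]), (-1, [0, 1, 2]), (-1, [1, 3, 5]), (1, [0, 1, 1,
    5]), (1, [0, 2, 2, 5]), (-1, [2, 2, 2, 3]), (-1, [2, 3, 3, 3]), (-1, [2, 3, 5, 5]), (1, [0, 1,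
    2, 3, 3]), (-1, [0, 1, 2, 5, 5]), (2, [1, 2, 2, 3, 5]), (1, [1, 3, 3, 3, 5]), (1, [1, 3, 5, 5,
    5]), (-1, [0, 1, 1, 3, 3, 5]), (-1, [0, 2, 2, 3, 3, 5]), (-1, [1, 1, 2, 3, 5, 5]), (1, [2, 2,
    2, 3, 3, 3]), (1, [2, 3, 3, 3, 5, 5]), (1, [0, 1, 2, 3, 3, 5, 5]), (-2, [1, 2, 2, 3, 3, 3,
    5]), (-1, [1, 3, 3, 3, 5, 5, 5]), (1, [1, 1, 2, 3, 3, 3, 5, 5])]) (n := 8)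
    (a := ![-1, 1, -1, 0, 0, 0]) (v := ![-1, 1, 1, 1, 0, 1]) (u := [-2721, 3315, -1496, 1654,
      6233, -6681, 2152]) (w := [459, 1004, -964, 311, -431, -962, 936, -269])
    (by simp [ofTerms]; ring) (by decide +kernel))
    (
  squarefree_of_eq_ofTerms (l := [(1, [1, 2]), (-1, [3, 4]), (-1, [1, 1, 5]), (-1, [2, 2, 5]), (1,
    [3, 3, 5]), (1, [4, 4, 5]), (1, [1, 1, 3, 4]), (-1, [1, 2, 3, 3]), (-1, [1, 2, 4, 4]), (1, [1,
    2, 5, 5]), (1, [2, 2, 3, 4]), (-1, [3, 4, 5, 5])]) (n := 4)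
    (a := ![0, -1, 1, -1, -1, 0]) (v := ![0, 1, 1, -1, 1, -1]) (u := [4]) (w := [0, -1])
    (by simp [ofTerms]; ring) (by decide +kernel))
  refine maskIdeal_isRadical_of_elimination [11, 15] ![X 0, X 1, X 2, X 3, X 4, X 5] _
    (by decide +kernel) (by decide) hG (fun B _ _ x h => ?_) ?_
  · simp [coupleMinor] at h
    simp [Fin.forall_fin_succ]
    grind
  · simp only [List.forall_mem_cons, Ideal.mem_span_pair]
    refine ⟨⟨1, 0, ?_⟩, ⟨0, 1, ?_⟩, by simp⟩ <;>
      simp [coupleMinor] <;> ring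

theorem isRadical_34817 : (maskIdeal 34817).IsRadical := by
  have hu : (X 1 : MvPolynomial (Fin 6) ℝ) ≠ 0 := by
    intro h
    have := congrArg (aeval (fun _ => 2 : Fin 6 → ℝ)) h
    norm_num [aeval_X] at this
  have hG := span_linear_pair_isRadical 5 (u := X 1)
    (v := X 2 * X 3 ^ 2 - X 2 - X 1 * X 3 * X 4)
    (u' := X 4)
    (v' := X 2 ^ 2 * X 3 - X 3 - X 1 * X 2 * X 4) hu
    (by simp) (aeval ![X 0, 0, X 2, X 3, X 4, X 5]) (by simp)
    (by simp [Fin.forall_fin_succ])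
    (
  squarefree_of_eq_ofTerms (l := [(1, [2, 3]), (-1, [2, 4, 5]), (-1, [2, 2, 2, 3]), (-1, [2, 3, 3,
    3]), (1, [2, 3, 3, 4, 5]), (1, [2, 2, 2, 3, 3, 3])]) (n := 6)
    (a := ![0, 0, 0, 0, 2, 1]) (v := ![0, 0, -1, 1, 1, 0]) (u := [-10, 48, -2, -36, 66]) (w := [9,
      10, -21, 4, 6, -11])
    (by simp [ofTerms]; ring) (by decide +kernel))
    (
  squarefree_of_eq_ofTerms (l := [(-1, [1, 3]), (1, [2, 4]), (-1, [1, 1, 2, 4]), (1, [1, 2, 2,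
    3]), (1, [1, 3, 4, 4]), (-1, [2, 3, 3, 4])]) (n := 4)
    (a := ![0, 1, 0, 1, 0, 0]) (v := ![0, 1, 1, -1, 1, 0]) (u := [-6, 0, -8]) (w := [0, 1, 0, 2])
    (by simp [ofTerms]; ring) (by decide +kernel))
  refine maskIdeal_isRadical_of_elimination [0, 11, 15] ![0, X 1, X 2, X 3, X 4, X 5] _
    (by decide +kernel) (by decide) hG (fun B _ _ x h => ?_) ?_
  · simp [coupleMinor] at h
    simp [Fin.forall_fin_succ]
    grind
  · simp only [List.forall_mem_cons, Ideal.mem_span_pair]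
    refine ⟨⟨0, 0, ?_⟩, ⟨-1, 0, ?_⟩, ⟨0, -1, ?_⟩, by simp⟩ <;>
      simp [coupleMinor] <;> ring

theorem isRadical_26624 : (maskIdeal 26624).IsRadical := by
  have hu : (X 4 : MvPolynomial (Fin 6) ℝ) ≠ 0 := by
    intro h
    have := congrArg (aeval (fun _ => 2 : Fin 6 → ℝ)) h
    norm_num [aeval_X] at this
  have hG := span_linear_pair_isRadical 5 (u := X 4)
    (v :=  - X 0 * X 1)
    (u' := X 0 ^ 2 * X 1 - X 1)
    (v' := X 2 - X 0 * X 4 + X 0 * X 1 ^ 2 * X 4 - X 0 ^ 2 * X 1 ^ 2 * X 2) hu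
    (by simp) (aeval ![X 0, X 1, X 2, X 3, 0, X 5]) (by simp)
    (by simp [Fin.forall_fin_succ])
    (
  squarefree_of_eq_ofTerms (l := [(-1, [0, 1, 2]), (1, [0, 1, 1, 5]), (-1, [0, 0, 0, 1, 1, 5]),
    (1, [0, 0, 0, 1, 1, 1, 2])]) (n := 7)
    (a := ![-2, 1, 0, 0, 0, 0]) (v := ![2, 1, 2, 0, 0, 0]) (u := [0, -57, 0, 280, 0, -196]) (w :=
      [-2, 0, 35, 0, -64, 0, 28])
    (by simp [ofTerms]; ring) (by decide +kernel))
    (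
  squarefree_of_eq_ofTerms (l := [(1, [2, 4]), (-1, [0, 1, 1]), (-1, [0, 4, 4]), (1, [0, 0, 0, 1,
    1]), (1, [0, 1, 1, 4, 4]), (-1, [0, 0, 1, 1, 2, 4])]) (n := 6)
    (a := ![0, 1, -2, 0, -1, 0]) (v := ![-1, 2, -1, 0, 1, 0]) (u := [66, 0, -156, 0, -648]) (w :=
      [0, -85, 0, -1, 0, 108])
    (by simp [ofTerms]; ring) (by decide +kernel))
  refine maskIdeal_isRadical_of_elimination [11, 13, 14] ![X 0, X 1, X 2, X 0 * X 1, X 4, X 5] _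
    (by decide +kernel) (by decide) hG (fun B _ _ x h => ?_) ?_
  · simp [coupleMinor] at h
    simp [Fin.forall_fin_succ]
    grind
  · simp only [List.forall_mem_cons, Ideal.mem_span_pair]
    refine ⟨⟨0, 1, ?_⟩, ⟨0, 0, ?_⟩, ⟨-1, 0, ?_⟩, by simp⟩ <;>
      simp [coupleMinor] <;> ring

/-- Two generators that are products of linear forms. -/
theorem span_mul_pair_isRadical (s : MvPolynomial (Fin 6) ℝ) (hs : s = 1 ∨ s = -1) :
    (Ideal.span {(X 0 + s * X 5) * (X 4 - X 1), (X 0 - s * X 5) * (X 4 + X 1)}).IsRadical := by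
  have hs2 : s * s = 1 := by rcases hs with rfl | rfl <;> ring
  have hφ : ∀ φ : MvPolynomial (Fin 6) ℝ →ₐ[ℝ] MvPolynomial (Fin 6) ℝ, φ s = s := fun φ => by
    rcases hs with rfl | rfl <;> simp
  have h1 : Squarefree (X 1 * (X 0 * X 0 - X 5 * X 5) : MvPolynomial (Fin 6) ℝ) :=
    squarefree_of_eq_ofTerms (l := [(1, [0, 0, 1]), (-1, [1, 5, 5])]) (n := 3)
    (a := ![1, -1, 0, 0, 0, 1]) (v := ![0, 1, 0, 0, 0, 2]) (u := [0, 9]) (w := [2, 0, -3])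
    (by simp [ofTerms]; ring) (by decide +kernel)
  have h2 : Squarefree (X 5 * (X 4 + X 1) : MvPolynomial (Fin 6) ℝ) :=
    squarefree_of_eq_ofTerms (l := [(1, [1, 5]), (1, [4, 5])]) (n := 2)
    (a := ![0, -2, 0, 0, 1, 1]) (v := ![0, 1, 0, 0, 0, 1]) (u := [-2]) (w := [0, 1])
    (by simp [ofTerms]; ring) (by decide +kernel)
  have hu2 : (2 : MvPolynomial (Fin 6) ℝ) * C 2⁻¹ = 1 := by
    rw [← map_ofNat (C : ℝ →+* MvPolynomial (Fin 6) ℝ), ← C_mul]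
    norm_num
  -- Split along `P = X 0 + s * X 5` and `Q = X 4 - X 1`. On `Q = 0` the other generator becomes `2
  -- * X 1 * (X 0 - s * X 5)`, which is coprime to `P`.
  refine span_mul_isRadical (aeval ![X 0, X 1, X 2, X 3, X 1, X 5]) (by simp)
    (by simp [Fin.forall_fin_succ]) ?_ ?_ ?_
  · simp only [map_add, map_sub, map_mul, hφ, aeval_X]
    refine IsRelPrime.of_squarefree_mul (h1.squarefree_of_dvd ⟨C 2⁻¹, ?_⟩)
    simp
    linear_combination (X 1 * X 5 * X 5) * hs2 -
      (X 1 * (X 0 * X 0 - s * s * X 5 * X 5)) * hu2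
  · refine isRadical_of_substitution (aeval ![-s * X 5, X 1, X 2, X 3, X 4, X 5])
      (span_isRadical_of_squarefree h2) ?_ ?_ ?_
    · rw [Ideal.span_singleton_le_iff_mem, Ideal.mem_span_pair]
      refine ⟨C 2⁻¹ * s * (X 4 + X 1), -C 2⁻¹ * s, ?_⟩
      linear_combination (X 5 * (X 4 + X 1)) * (2 * C 2⁻¹ * hs2 + hu2)
    · rw [Ideal.span_le]
      rintro g (rfl | rfl) <;> refine Ideal.mem_span_singleton.2 ?_ <;> simp [hφ]
      exact ⟨-s - s, by ring⟩
    · simp [Fin.forall_fin_succ]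
      exact Ideal.subset_span (by simp)
  · refine isRadical_of_substitution (J := Ideal.span {(X 0 - s * X 5) * X 1})
      (aeval ![X 0, X 1, X 2, X 3, X 1, X 5])
      (span_isRadical_of_squarefree (h1.squarefree_of_dvd ⟨X 0 + s * X 5, ?_⟩)) ?_ ?_ ?_
    · linear_combination (X 1 * X 5 * X 5) * hs2
    · rw [Ideal.span_singleton_le_iff_mem, Ideal.mem_span_pair]
      refine ⟨-C 2⁻¹ * (X 0 - s * X 5), C 2⁻¹, ?_⟩
      linear_combination ((X 0 - s * X 5) * X 1) * hu2
    · rw [Ideal.span_le]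
      rintro g (rfl | rfl) <;> refine Ideal.mem_span_singleton.2 ?_ <;> simp [hφ]
      exact ⟨2, by ring⟩
    · simp [Fin.forall_fin_succ]
      exact Ideal.subset_span (by simp)

/-- What remains is `X 0 * X 4 = X 1 * X 5` and `X 0 * X 1 = X 4 * X 5`. The sum and the difference
of these equations factor into linear forms, and the halves recover them. -/
theorem isRadical_26112 : (maskIdeal 26112).IsRadical := by
  have hu2 : (2 : MvPolynomial (Fin 6) ℝ) * C 2⁻¹ = 1 := by
    rw [← map_ofNat (C : ℝ →+* MvPolynomial (Fin 6) ℝ), ← C_mul]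
    norm_num
  refine maskIdeal_isRadical_of_elimination [9, 10, 13, 14]
    ![X 0, X 1, X 0 * X 4, X 0 * X 1, X 4, X 5] _ (by decide +kernel) (by decide)
    (span_mul_pair_isRadical 1 (Or.inl rfl)) (fun B _ _ x h => ?_) ?_
  · simp [coupleMinor] at h
    simp [Fin.forall_fin_succ]
    grind
  · simp only [List.forall_mem_cons, Ideal.mem_span_pair]
    refine ⟨⟨0, 0, ?_⟩, ⟨C 2⁻¹, C 2⁻¹, ?_⟩, ⟨0, 0, ?_⟩, ⟨-C 2⁻¹, C 2⁻¹, ?_⟩, by simp⟩ <;>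
      simp [coupleMinor]
    · linear_combination (X 0 * X 4 - X 1 * X 5) * hu2
    · linear_combination (X 0 * X 1 - X 4 * X 5) * hu2

theorem isRadical_39168 : (maskIdeal 39168).IsRadical := by
  have hu2 : (2 : MvPolynomial (Fin 6) ℝ) * C 2⁻¹ = 1 := by
    rw [← map_ofNat (C : ℝ →+* MvPolynomial (Fin 6) ℝ), ← C_mul]
    norm_num
  refine maskIdeal_isRadical_of_elimination [8, 11, 12, 15]
    ![X 0, X 1, 0, 0, X 4, X 5] _ (by decide +kernel) (by decide)
    (span_mul_pair_isRadical (-1) (Or.inr rfl)) (fun B _ _ x h => ?_) ?_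
  · simp [coupleMinor] at h
    simp [Fin.forall_fin_succ]
    grind
  · simp only [List.forall_mem_cons, Ideal.mem_span_pair]
    refine ⟨⟨0, 0, ?_⟩, ⟨-C 2⁻¹, -C 2⁻¹, ?_⟩, ⟨0, 0, ?_⟩, ⟨C 2⁻¹, -C 2⁻¹, ?_⟩, by simp⟩ <;>
      simp [coupleMinor]
    · linear_combination -(X 0 * X 4 + X 1 * X 5) * hu2
    · linear_combination -(X 0 * X 1 + X 4 * X 5) * hu2

/-! ### The two exceptional representatives -/

/-- The relation `{14, 14|23, 23|1, 23|4}` is not representable. -/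
theorem radicalIfRepresentable_26880 : RadicalIfRepresentable 26880 := by
  intro x hx hv
  have h2 : x 2 = 0 := (hv 8).1 (by decide)
  have h11 := (hv 11).1 (by decide)
  have h13 := (hv 13).1 (by decide)
  have h14 := (hv 14).1 (by decide)
  have h0 : x 0 ≠ 0 := fun h => absurd ((hv 0).2 h) (by decide)
  have h1 : x 1 ≠ 0 := fun h => absurd ((hv 4).2 h) (by decide)
  have p0 := hx.two_minor_pos 0 1 (by decide)
  have p1 := hx.two_minor_pos 0 2 (by decide)
  simp [coupleMinor, corMatrix] at h11 h13 h14 p0 p1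
  -- This is `h11` times `x 5`, after inserting `x 4 * x 5 = x 3 = x 0 * x 1`.
  have key : x 1 * (x 0 ^ 2 * (1 - x 1 * x 1) + x 5 ^ 2 * (1 - x 0 * x 0)) = 0 := by
    grind
  have : 0 < x 0 ^ 2 * (1 - x 1 * x 1) := mul_pos (by positivity) (by linarith)
  have : 0 ≤ x 5 ^ 2 * (1 - x 0 * x 0) := mul_nonneg (by positivity) (by linarith)
  exact absurd ((mul_eq_zero.1 key).resolve_left h1) (by linarith)

/-- The relation `{13, 14|23, 23|14, 24}` is not representable. -/
theorem radicalIfRepresentable_100368 : RadicalIfRepresentable 100368 := by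
  intro x hx hv
  have h1 : x 1 = 0 := (hv 4).1 (by decide)
  have h4 : x 4 = 0 := (hv 16).1 (by decide)
  have h11 := (hv 11).1 (by decide)
  have h15 := (hv 15).1 (by decide)
  have h2 : x 2 ≠ 0 := fun h => absurd ((hv 8).2 h) (by decide)
  have p0 := hx.three_minor_pos 1 3 0 (by decide) (by decide) (by decide)
  have p1 := hx.three_minor_pos 0 2 3 (by decide) (by decide) (by decide)
  simp [coupleMinor, corMatrix, h1, h4] at h11 h15 p0 p1
  have hsq : x 2 ^ 2 = x 3 ^ 2 := by
    linear_combination x 2 * h11 - x 3 * h15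
  -- Square `x 2 * (1 - x 3 ^ 2) = -(x 0 * x 3 * x 5)` and use `hsq`. But `p0` and `p1` say that `x
  -- 0 ^ 2` and `x 5 ^ 2` are both less than `1 - x 2 ^ 2`.
  have key : (x 2 ^ 2) * ((1 - x 2 ^ 2) ^ 2 - x 0 ^ 2 * x 5 ^ 2) = 0 := by
    grind
  have := (mul_eq_zero.1 key).resolve_left (pow_ne_zero 2 h2)
  nlinarith [sq_nonneg (x 0), sq_nonneg (x 5), mul_nonneg (sq_nonneg (x 0)) (sq_nonneg (x 5))]

theorem radicalIfRepresentable_of_mem_gaussoidMasks :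
    ∀ v ∈ gaussoidMasks, RadicalIfRepresentable v := by
  simp only [gaussoidMasks, List.forall_mem_cons]
  exact ⟨fun _ _ _ => isRadical_0, fun _ _ _ => isRadical_1, fun _ _ _ => isRadical_2,
    fun _ _ _ => isRadical_8, fun _ _ _ => isRadical_6, fun _ _ _ => isRadical_9,
    fun _ _ _ => isRadical_20, fun _ _ _ => isRadical_24, fun _ _ _ => isRadical_36,
    fun _ _ _ => isRadical_40, fun _ _ _ => isRadical_4352, fun _ _ _ => isRadical_4608,
    fun _ _ _ => isRadical_6144, fun _ _ _ => isRadical_8704, fun _ _ _ => isRadical_10240,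
    fun _ _ _ => isRadical_34816, fun _ _ _ => isRadical_296, fun _ _ _ => isRadical_578,
    fun _ _ _ => isRadical_4360, fun _ _ _ => isRadical_4616, fun _ _ _ => isRadical_4672,
    fun _ _ _ => isRadical_5632, fun _ _ _ => isRadical_6148, fun _ _ _ => isRadical_6400,
    fun _ _ _ => isRadical_8712, fun _ _ _ => isRadical_8768, fun _ _ _ => isRadical_9728,
    fun _ _ _ => isRadical_10244, fun _ _ _ => isRadical_10496, fun _ _ _ => isRadical_16912,
    fun _ _ _ => isRadical_18433, fun _ _ _ => isRadical_26624, fun _ _ _ => isRadical_34817,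
    fun _ _ _ => isRadical_35072, fun _ _ _ => isRadical_51, fun _ _ _ => isRadical_204,
    fun _ _ _ => isRadical_26112, radicalIfRepresentable_26880, fun _ _ _ => isRadical_39168,
    fun _ _ _ => isRadical_74880, fun _ _ _ => isRadical_75840, radicalIfRepresentable_100368,
    fun _ _ _ => isRadical_148512, fun _ _ _ => isRadical_4300, fun _ _ _ => isRadical_8396,
    fun _ _ _ => isRadical_12340, fun _ _ _ => isRadical_12344, fun _ _ _ => isRadical_12339,
    fun _ _ _ => isRadical_49356, fun _ _ _ => isRadical_13063, fun _ _ _ => isRadical_15024,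
    fun _ _ _ => isRadical_51936, fun _ _ _ => isRadical_4095, fun _ _ _ => isRadical_16383,
    fun _ _ _ => isRadical_53247, fun _ _ _ => isRadical_1048560,
    fun _ _ _ => isRadical_1048575, fun _ _ _ => isRadical_16777215,
    by simp⟩

/-! ### The two ideals that are not radical, and completeness -/

theorem maskIdeal_isRadical_of_ciIdeal (L : CIRelation 4) (v : ℕ)
    (hv : ∀ n : Fin 24, v.testBit n = true ↔ couple n ∈ L) (h : L.ciIdeal.IsRadical) :
    (maskIdeal v).IsRadical := by
  have h1 : maskIdeal v = L.ciIdeal.comap (renameEquiv ℝ varEquiv).toRingEquiv := by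
    rw [ciIdeal_eq_comap_maskIdeal L v hv]
    ext g
    rw [Ideal.mem_comap, Ideal.mem_comap, RingEquiv.symm_apply_apply]
  rw [h1]
  exact h.comap _

/-- Dual numbers detect that an ideal is not radical. -/
theorem not_maskIdeal_isRadical {v : ℕ} (g : MvPolynomial (Fin 6) ℝ)
    (hg : ∀ (B : Type) [CommRing B] [Algebra ℝ B] (x : Fin 6 → B),
      (∀ n : Fin 24, v.testBit n = true → coupleMinor n x = 0) → aeval x (g ^ 2) = 0)
    (y : Fin 6 → DualNumber ℝ)
    (hy : ∀ n : Fin 24, v.testBit n = true → coupleMinor n y = 0) (hyg : aeval y g ≠ 0) :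
    ¬ (maskIdeal v).IsRadical := fun h =>
  hyg (aeval_eq_zero_of_mem_maskIdeal (h ⟨2, mem_maskIdeal hg⟩) y hy)

theorem not_maskIdeal_199685_isRadical : ¬ (maskIdeal 199685).IsRadical := by
  have hbits : ∀ n : Fin 24, (199685 : ℕ).testBit n = true ↔
      n ∈ ([0, 2, 10, 11, 16, 17] : List (Fin 24)) := by decide +kernel
  -- The ideal is `(r₁₂, r₂₄, r₁₄ - r₁₃r₃₄, r₁₄r₂₃²)`, so `r₁₄r₂₃` is nilpotent modulo it, but
  -- equals `ε` at the chosen point.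
  refine not_maskIdeal_isRadical (X 2 * X 3) (fun B _ _ x h => ?_)
    ![0, 1, 1, DualNumber.eps, 0, 1] ?_ ?_
  · simp only [hbits, List.forall_mem_cons] at h
    simp [coupleMinor] at h
    simp
    grind
  · simp only [hbits, List.forall_mem_cons]
    simp [coupleMinor, pow_two]
  · simp
    intro h
    simpa using congrArg TrivSqZeroExt.snd h

theorem not_maskIdeal_35841_isRadical : ¬ (maskIdeal 35841).IsRadical := by
  have hbits : ∀ n : Fin 24, (35841 : ℕ).testBit n = true ↔
      n ∈ ([0, 10, 11, 15] : List (Fin 24)) := by decide +kernel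
  -- With `r₁₂ = 0` and `r₁₄ = r₁₃r₃₄`, the equation `r2` below determines `r₂₃` as a multiple of
  -- `r₂₄`, up to a denominator. Then `r1` becomes `r₂₄²` times `r₁₃r₃₄(1 - r₁₃²)(1 - r₃₄²)`. At the
  -- point, `r₂₃ = 2ε` and `r₂₄ = 5ε` solve `r2` for `r₁₃ = r₃₄ = 2`.
  refine not_maskIdeal_isRadical (X 4 * (X 1 * X 5 * (1 - X 1 ^ 2) * (1 - X 5 ^ 2)))
    (fun B _ _ x h => ?_)
    ![0, 2, 4, 2 * DualNumber.eps, 5 * DualNumber.eps, 2] ?_ ?_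
  · simp only [hbits, List.forall_mem_cons] at h
    simp [coupleMinor] at h
    obtain ⟨h0, h1, h2, h3⟩ := h
    rw [h0, sub_eq_zero.1 h1] at h2 h3
    simp
    have r1 : x 1 * x 3 * (x 4 - x 3 * x 5) = 0 := by linear_combination h2
    have r2 : x 3 * (1 - x 1 ^ 2 * x 5 ^ 2) - x 4 * x 5 * (1 - x 1 ^ 2) = 0 := by
      linear_combination h3
    linear_combination (x 1 * x 5 * (1 - x 1 ^ 2) * (1 - x 5 ^ 2)) *
      ((1 - x 1 ^ 2 * x 5 ^ 2) ^ 2 * r1 - x 1 * ((1 - x 1 ^ 2 * x 5 ^ 2) * x 4 -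
        2 * x 5 * (x 4 * x 5 * (1 - x 1 ^ 2)) - x 5 * (x 3 * (1 - x 1 ^ 2 * x 5 ^ 2) -
        x 4 * x 5 * (1 - x 1 ^ 2))) * r2)
  · have he : (DualNumber.eps : DualNumber ℝ) * DualNumber.eps = 0 := DualNumber.eps_mul_eps
    simp only [hbits, List.forall_mem_cons]
    simp [coupleMinor]
    refine ⟨?_, ?_, ?_⟩
    · ring
    · linear_combination (4 : DualNumber ℝ) * he
    · ring
  · simp
    intro h
    have h' : (180 : ℝ) • (DualNumber.eps : DualNumber ℝ) = 0 := by
      rw [Algebra.smul_def, map_ofNat]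
      linear_combination h
    simpa using congrArg TrivSqZeroExt.snd h'

/-- Diagonal dominance: the six off-diagonal terms cost at most 3/4 of the squared norm. -/
theorem corMatrix_posDef_of_abs_le {x : Fin 6 → ℝ} (hx : ∀ i, |x i| ≤ 1 / 4) :
    (corMatrix x).PosDef := by
  refine Matrix.PosDef.of_dotProduct_mulVec_pos ?_ fun y hy => ?_
  · ext i j
    simpa using corMatrix_symm x j i
  · have hb : ∀ i (s t : ℝ), -(1 / 4) * (s ^ 2 + t ^ 2) ≤ 2 * (x i * (s * t)) := fun i s t => by
      have h := abs_le.1 (hx i)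
      nlinarith [mul_nonneg (sub_nonneg.2 h.2) (sq_nonneg (s - t)),
        mul_nonneg (by linarith [h.1] : 0 ≤ x i + 1 / 4) (sq_nonneg (s + t))]
    have hpos : 0 < y 0 ^ 2 + y 1 ^ 2 + y 2 ^ 2 + y 3 ^ 2 := by
      obtain ⟨i, hi⟩ := Function.ne_iff.1 hy
      have := sq_nonneg (y 0)
      have := sq_nonneg (y 1)
      have := sq_nonneg (y 2)
      have := sq_nonneg (y 3)
      have h := sq_pos_of_ne_zero hi
      have hle : ∀ i, y i ^ 2 ≤ y 0 ^ 2 + y 1 ^ 2 + y 2 ^ 2 + y 3 ^ 2 := by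
        simp only [Fin.forall_fin_succ, IsEmpty.forall_iff, and_true, Fin.isValue]
        refine ⟨?_, ?_, ?_, ?_⟩
        · linarith
        · change y 1 ^ 2 ≤ _
          linarith
        · change y 2 ^ 2 ≤ _
          linarith
        · change y 3 ^ 2 ≤ _
          linarith
      exact h.trans_le (hle i)
    simp [dotProduct, Matrix.mulVec, Fin.sum_univ_four, corMatrix]
    nlinarith [hb 0 (y 0) (y 1), hb 1 (y 0) (y 2), hb 2 (y 0) (y 3), hb 3 (y 1) (y 2),
      hb 4 (y 1) (y 3), hb 5 (y 2) (y 3)]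

theorem complete_of_points (L : CIRelation 4) (v : ℕ)
    (hv : ∀ n : Fin 24, v.testBit n = true ↔ couple n ∈ L)
    (h : ∀ n : Fin 24, v.testBit n = false → ∃ x : Fin 6 → ℝ, (corMatrix x).PosDef ∧
      (∀ k : Fin 24, v.testBit k = true → coupleMinor k x = 0) ∧ coupleMinor n x ≠ 0) :
    L.Complete := by
  ext c
  constructor
  · exact fun hc S hS => hS.2 c hc
  · intro hc
    obtain ⟨n, rfl⟩ := exists_couple_eq c
    by_contra hn
    rw [← hv, Bool.not_eq_true] at hn
    obtain ⟨x, hx, hxL, hxn⟩ := h n hn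
    refine hxn ((minor_couple n x).symm.trans (hc _ ⟨hx, fun c hc => ?_⟩))
    obtain ⟨k, rfl⟩ := exists_couple_eq c
    rw [minor_couple]
    exact hxL k ((hv k).2 hc)

theorem exists_point_199685 (n : Fin 24) (hn : (199685 : ℕ).testBit n = false) :
    ∃ x : Fin 6 → ℝ, (corMatrix x).PosDef ∧
      (∀ k : Fin 24, (199685 : ℕ).testBit k = true → coupleMinor k x = 0) ∧
      coupleMinor n x ≠ 0 := by
  have hbits : ∀ n : Fin 24, (199685 : ℕ).testBit n = true ↔
      n ∈ ([0, 2, 10, 11, 16, 17] : List (Fin 24)) := by decide +kernel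
  have h1 : n ∈ ([4, 5, 6, 7, 8, 9, 20, 21, 22, 23] : List (Fin 24)) ∨
      n ∈ ([12, 13, 14, 15, 18, 19] : List (Fin 24)) ∨ n ∈ ([1, 3] : List (Fin 24)) := by
    revert n
    decide +kernel
  -- The variety has the components `r₂₃ = 0`, `r₁₃ = r₁₄ = 0` and `r₃₄ = r₁₄ = 0` within `r₁₂ = r₂₄
  -- = 0`, `r₁₄ = r₁₃r₃₄`. One point on each of them violates all missing couples between them.
  rcases h1 with h | h | h
  · refine ⟨![0, 1 / 4, 1 / 16, 0, 0, 1 / 4], corMatrix_posDef_of_abs_le ?_, ?_, ?_⟩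
    · simp [Fin.forall_fin_succ, abs_of_pos]
      norm_num [abs_of_pos]
    · simp only [hbits, List.forall_mem_cons]
      simp [coupleMinor]
      norm_num
    · simp only [List.mem_cons, List.not_mem_nil, or_false] at h
      rcases h with rfl | rfl | rfl | rfl | rfl | rfl | rfl | rfl | rfl | rfl <;>
        simp [coupleMinor] <;> norm_num
  · refine ⟨![0, 0, 0, 1 / 4, 0, 1 / 4], corMatrix_posDef_of_abs_le ?_, ?_, ?_⟩
    · simp [Fin.forall_fin_succ, abs_of_pos]
    · simp only [hbits, List.forall_mem_cons]
      simp [coupleMinor]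
    · simp only [List.mem_cons, List.not_mem_nil, or_false] at h
      rcases h with rfl | rfl | rfl | rfl | rfl | rfl <;> simp [coupleMinor]
  · refine ⟨![0, 1 / 4, 0, 1 / 4, 0, 0], corMatrix_posDef_of_abs_le ?_, ?_, ?_⟩
    · simp [Fin.forall_fin_succ, abs_of_pos]
    · simp only [hbits, List.forall_mem_cons]
      simp [coupleMinor]
    · simp only [List.mem_cons, List.not_mem_nil, or_false] at h
      rcases h with rfl | rfl <;> simp [coupleMinor]

end

theorem testBit_199685_iff (n : Fin 24) : (199685 : ℕ).testBit n = true ↔ couple n ∈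
    ({CICouple.mk 0 1 ∅, CICouple.mk 0 1 {3}, CICouple.mk 0 3 {2}, CICouple.mk 0 3 {1, 2},
      CICouple.mk 1 3 ∅, CICouple.mk 1 3 {0}} : CIRelation 4) := by
  simp only [Set.mem_insert_iff, Set.mem_singleton_iff, CICouple.ext_iff]
  revert n
  decide +kernel

theorem testBit_35841_iff (n : Fin 24) : (35841 : ℕ).testBit n = true ↔ couple n ∈
    ({CICouple.mk 0 1 ∅, CICouple.mk 0 3 {2}, CICouple.mk 0 3 {1, 2},
      CICouple.mk 1 2 {0, 3}} : CIRelation 4) := by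
  simp only [Set.mem_insert_iff, Set.mem_singleton_iff, CICouple.ext_iff]
  revert n
  decide +kernel

/-- The elements `1, 2, 3, 4` of `[4]` are `0, 1, 2, 3 : Fin 4`.  The second part is about
`{12, 12|4, 14|3, 14|23, 24, 24|1}`, the third one about `{12, 14|3, 14|23, 23|14}`. -/
theorem mainTheorem10 :
    (∀ L : CIRelation 4, L.Representable → L.ciIdeal.IsRadical) ∧
    (∃ L : CIRelation 4,
      L = {CICouple.mk 0 1 ∅, CICouple.mk 0 1 {3}, CICouple.mk 0 3 {2}, CICouple.mk 0 3 {1, 2},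
        CICouple.mk 1 3 ∅, CICouple.mk 1 3 {0}} ∧
      L.Complete ∧ ¬ L.ciIdeal.IsRadical) ∧
    (∃ L : CIRelation 4,
      L = {CICouple.mk 0 1 ∅, CICouple.mk 0 3 {2}, CICouple.mk 0 3 {1, 2},
        CICouple.mk 1 2 {0, 3}} ∧
      ¬ L.ciIdeal.IsRadical) :=
  ⟨fun L hL =>
      ciIdeal_isRadical_of_representable radicalIfRepresentable_of_mem_gaussoidMasks L hL,
    ⟨_, rfl, complete_of_points _ 199685 testBit_199685_iff exists_point_199685,
      fun h => not_maskIdeal_199685_isRadical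
        (maskIdeal_isRadical_of_ciIdeal _ 199685 testBit_199685_iff h)⟩,
    ⟨_, rfl, fun h => not_maskIdeal_35841_isRadical
      (maskIdeal_isRadical_of_ciIdeal _ 35841 testBit_35841_iff h)⟩⟩
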